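/- For $k\ge 0$ let $\Sigma_k=\Gamma\cup\Gamma^{-1}$, where $\Gamma=\{1,\dots,k\}$ and $\Gamma^{-1}=\{1^{-1},\dots,k^{-1}\}$, with $(a^{-1})^{-1}=a$. For a word $w\in\Sigma_k^*$ let $r(w)$ be its reduced representation, that is, the unique word without factors of the form $aa^{-1}$ ($a\in\Sigma_k$) that is obtained from $w$ by repeatedly deleting such factors, and for $L\subseteq\Sigma_k^*$ let $r(L)=\{r(w):w\in L\}$. There is an algorithm that, given $k$ and an $\epsilon$-NFA $M=(Q,\Sigma_k,\delta,q_0,F)$ with $n$ states, builds an $\epsilon$-NFA $M_r$ over $\Sigma_k$ such that $L(M_r)=r(L(M))$. For every fixed $k$ its running time is $O(n^4)$, with a constant that may depend on $k$. (The running time is the number of steps on a random access machine with words of $O(\log n)$ bits; automata are given by their number of states, initial state, transition table and table of accepting states.) -/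

import Mathlib

/-! ## A random access machine with a step count

Programs are finite pieces of syntax. They work on variables and on arrays, both named by natural
numbers; a program mentions only finitely many of them. Array entries are accessed by a computed
index in constant time. Every operation of a program takes one step, and every number that
occurs during a run has to fit into a machine word. -/

namespace RAM

/-- The memory: the values of the variables and the contents of the arrays. -/
structure Store where
  /-- `var x` is the value of variable `x` -/
  var : ℕ → ℕ
  /-- `arr a i` is the entry of array `a` at index `i` -/
  arr : ℕ → ℕ → ℕ

/-- The store after writing `v` into variable `x`. -/
def Store.setVar (s : Store) (x v : ℕ) : Store :=
  { s with var := Function.update s.var x v }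

/-- The store after writing `v` into entry `i` of array `a`. -/
def Store.setArr (s : Store) (a i v : ℕ) : Store :=
  { s with arr := Function.update s.arr a (Function.update (s.arr a) i v) }

/-- Arithmetic expressions over the memory. -/
inductive Expr : Type
  /-- a constant -/
  | lit (c : ℕ)
  /-- the value of a variable -/
  | var (x : ℕ)
  /-- the entry of array `a` at a computed index -/
  | get (a : ℕ) (i : Expr)
  | add (e f : Expr)
  /-- subtraction, with value `0` if the second operand is larger -/
  | sub (e f : Expr)
  | mul (e f : Expr)
  /-- rounded down, with value `0` if the second operand is `0` -/
  | div (e f : Expr)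

/-- The value of an expression. -/
def Expr.eval (s : Store) : Expr → ℕ
  | lit c => c
  | var x => s.var x
  | get a i => s.arr a (i.eval s)
  | add e f => e.eval s + f.eval s
  | sub e f => e.eval s - f.eval s
  | mul e f => e.eval s * f.eval s
  | div e f => e.eval s / f.eval s

/-- The number of steps needed to evaluate an expression: one for each operation in it. -/
def Expr.cost : Expr → ℕ
  | lit _ => 1
  | var _ => 1
  | get _ i => i.cost + 1
  | add e f => e.cost + f.cost + 1
  | sub e f => e.cost + f.cost + 1
  | mul e f => e.cost + f.cost + 1
  | div e f => e.cost + f.cost + 1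

/-- All numbers that occur in the evaluation of the expression, intermediate ones included, are
at most `B`. -/
def Expr.Fits (B : ℕ) (s : Store) : Expr → Prop
  | lit c => c ≤ B
  | var x => s.var x ≤ B
  | get a i => i.Fits B s ∧ s.arr a (i.eval s) ≤ B
  | add e f => e.Fits B s ∧ f.Fits B s ∧ e.eval s + f.eval s ≤ B
  | sub e f => e.Fits B s ∧ f.Fits B s
  | mul e f => e.Fits B s ∧ f.Fits B s ∧ e.eval s * f.eval s ≤ B
  | div e f => e.Fits B s ∧ f.Fits B s

/-- Programs. A test succeeds if the value of its expression is not `0`. -/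
inductive Prog : Type
  | skip
  /-- `x := e` -/
  | assign (x : ℕ) (e : Expr)
  /-- `a[i] := e` -/
  | write (a : ℕ) (i e : Expr)
  | seq (P Q : Prog)
  | ite (e : Expr) (P Q : Prog)
  | while (e : Expr) (P : Prog)

/-- `Runs B P s t s'`: on a machine whose words hold the numbers from `0` to `B`, the program `P`,
started with memory `s`, halts after `t` steps with memory `s'`, and no overflow occurs. A program
that does not halt, or that computes a number larger than `B`, has no run. -/
inductive Runs (B : ℕ) : Prog → Store → ℕ → Store → Prop
  | skip (s : Store) : Runs B .skip s 1 s
  | assign (s : Store) (x : ℕ) (e : Expr) (h : e.Fits B s) :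
      Runs B (.assign x e) s (e.cost + 1) (s.setVar x (e.eval s))
  | write (s : Store) (a : ℕ) (i e : Expr) (hi : i.Fits B s) (h : e.Fits B s) :
      Runs B (.write a i e) s (i.cost + e.cost + 1) (s.setArr a (i.eval s) (e.eval s))
  | seq {P Q : Prog} {s s₁ s₂ : Store} {t₁ t₂ : ℕ} (hP : Runs B P s t₁ s₁)
      (hQ : Runs B Q s₁ t₂ s₂) : Runs B (.seq P Q) s (t₁ + t₂) s₂
  | ite_true {e : Expr} {P : Prog} (Q : Prog) {s s₁ : Store} {t : ℕ} (hf : e.Fits B s)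
      (he : e.eval s ≠ 0) (hP : Runs B P s t s₁) : Runs B (.ite e P Q) s (e.cost + 1 + t) s₁
  | ite_false {e : Expr} (P : Prog) {Q : Prog} {s s₁ : Store} {t : ℕ} (hf : e.Fits B s)
      (he : e.eval s = 0) (hQ : Runs B Q s t s₁) : Runs B (.ite e P Q) s (e.cost + 1 + t) s₁
  | while_true {e : Expr} {P : Prog} {s s₁ s₂ : Store} {t₁ t₂ : ℕ} (hf : e.Fits B s)
      (he : e.eval s ≠ 0) (hP : Runs B P s t₁ s₁) (hW : Runs B (.while e P) s₁ t₂ s₂) :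
      Runs B (.while e P) s (e.cost + 1 + t₁ + t₂) s₂
  | while_false {e : Expr} (P : Prog) {s : Store} (hf : e.Fits B s) (he : e.eval s = 0) :
      Runs B (.while e P) s (e.cost + 1) s

end RAM

/-! ## Words with inverse letters, and automata over them -/

/-- The alphabet `Γ ∪ Γ⁻¹` with `k` letters in `Γ`: the pair `(i, true)` is the `i`-th letter of `Γ`
and `(i, false)` is its inverse. -/
abbrev Letter (k : ℕ) : Type := Fin k × Bool

/-- The language `r(L)` of the reduced representations of the words of `L`. Here `FreeGroup.reduce w`
is the word obtained from `w` by deleting factors `a a⁻¹`, with `a ∈ Γ ∪ Γ⁻¹`, as long as there are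
any. -/
def reducedLanguage {k : ℕ} (L : Language (Letter k)) : Language (Letter k) :=
  {u | ∃ w ∈ L, FreeGroup.reduce w = u}

/-- The number of a transition label: `0` for `ε`, and `1, …, 2k` for the letters. -/
def labelCode {k : ℕ} : Option (Letter k) → ℕ
  | none => 0
  | some (i, b) => 1 + 2 * (i : ℕ) + b.toNat

open Classical in
/-- The memory `s` holds the `ε`-NFA `M`, with states `0, …, n - 1` and with the single initial state
`q₀`: the number of states is in variable `xn`, the initial state in variable `xq`, the transition
table (one entry `0` or `1` for each state, label and state) in array `aδ`, and the characteristic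
function of the set of accepting states in array `aF`. -/
def RAM.Store.Holds {k n : ℕ} (s : RAM.Store) (xn xq aδ aF : ℕ)
    (M : εNFA (Letter k) (Fin n)) (q₀ : Fin n) : Prop :=
  M.start = {q₀} ∧ s.var xn = n ∧ s.var xq = q₀ ∧
  (∀ (p : Fin n) (l : Option (Letter k)) (q : Fin n),
    s.arr aδ (((p : ℕ) * (2 * k + 1) + labelCode l) * n + q) = if q ∈ M.step p l then 1 else 0) ∧
  (∀ p : Fin n, s.arr aF p = if p ∈ M.accept then 1 else 0)

/-! ## Automata for languages of reduced words -/

/-! Call a pair of states `(p, q)` cancelling if some path from `p` to `q` spells a word that is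
trivial in the free group. Cancelling pairs form a relation that is reflexive, transitive, contains
the `ε`-transitions, and is closed under prefixing a letter `a` and appending `a⁻¹`. Let `R` be any
relation with these closure properties all of whose pairs are cancelling, and use `R` as the
`ε`-transitions. Closure lets every cancellation `a a⁻¹` along a path be replaced by an `R`-step
(`satPath_of_red`), so the reduced form of every accepted word can be read; conversely an `R`-step
stands for a path with trivial word (`SatPath.exists_isPath`), so a reduced word that can be read is
the reduced form of an accepted one. Remembering the last letter in the state, with `2k + 1`
possible values, excludes the words that are not reduced (`accepts_reducedNFA`).

Such an `R` is computed by saturation. A pair is marked `1` when found and `2` when it is processed,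
that is, when all its consequences by transitivity and by the letter rule are marked. Each of the
`n²` pairs is processed at most once, and processing tests `n²` pairs for each of the `2k + 1`
labels, so `n⁴ (2k + 1)` tests suffice; finding the next pair by scanning the whole array costs only
`n²` per round. `SatInv.next` and `SatInv.tableClosed` contain the correctness of this procedure,
`wp_saturate` its cost. Writing the new transition table takes `O((2k + 1)³ n²)` steps, and its
length also governs the word size. -/

namespace εNFA

variable {α σ τ : Type*}

/-- A relation on the states is closed under cancellation if it is reflexive and transitive,
contains the `ε`-transitions, and can be extended by a letter on the left and its inverse on the
right. -/
structure IsCancelClosed (M : εNFA (α × Bool) σ) (R : σ → σ → Prop) : Prop where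
  refl : ∀ p, R p p
  trans : ∀ p q r, R p q → R q r → R p r
  eps : ∀ p q, q ∈ M.step p none → R p q
  letter : ∀ (a : α × Bool) (p p' q' q : σ), p' ∈ M.step p (some a) → R p' q' →
    q ∈ M.step q' (some (a.1, !a.2)) → R p q

/-- There is a path from `p` to `q` whose word is trivial in the free group. -/
def Cancels (M : εNFA (α × Bool) σ) (p q : σ) : Prop :=
  ∃ x, M.IsPath p q x ∧ FreeGroup.mk x.reduceOption = 1

/-- Besides showing that the closure rules are sound, this provides the upper bound for the
saturation: whatever the rules produce from pairs in `Cancels` stays in `Cancels`. -/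
theorem isCancelClosed_cancels (M : εNFA (α × Bool) σ) : M.IsCancelClosed M.Cancels where
  refl p := ⟨[], .nil p, rfl⟩
  trans := by
    rintro p q r ⟨x, hx, hx'⟩ ⟨y, hy, hy'⟩
    refine ⟨x ++ y, M.isPath_append.2 ⟨q, hx, hy⟩, ?_⟩
    rw [List.reduceOption_append, ← FreeGroup.mul_mk, hx', hy', one_mul]
  eps p q h := ⟨[none], IsPath.singleton M h, rfl⟩
  letter := by
    rintro a p p' q' q hp ⟨x, hx, hx'⟩ hq
    refine ⟨some a :: (x ++ [some (a.1, !a.2)]), .cons p' _ _ _ _ hp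
      (M.isPath_append.2 ⟨q', hx, IsPath.singleton M hq⟩), ?_⟩
    have h : some a :: (x ++ [some (a.1, !a.2)]) = [some a] ++ x ++ [some (a.1, !a.2)] := by simp
    rw [h, List.reduceOption_append, List.reduceOption_append, ← FreeGroup.mul_mk,
      ← FreeGroup.mul_mk, hx', mul_one, FreeGroup.mul_mk]
    exact _root_.Quot.sound
      (FreeGroup.Red.Step.not (L₁ := []) (L₂ := []) (x := a.1) (b := a.2))

/-- Paths of the automaton whose `ε`-transitions are given by `R` and whose letter transitions are
those of `M`. -/
def SatPath (M : εNFA (α × Bool) σ) (R : σ → σ → Prop) : σ → List (α × Bool) → σ → Prop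
  | p, [], q => R p q
  | p, a :: w, q => ∃ p₁ p₂, R p p₁ ∧ p₂ ∈ M.step p₁ (some a) ∧ SatPath M R p₂ w q

variable {M : εNFA (α × Bool) σ} {R : σ → σ → Prop}

theorem IsCancelClosed.satPath_of_rel (hR : M.IsCancelClosed R) {p q r : σ}
    {w : List (α × Bool)} (h : R p q) (hw : M.SatPath R q w r) : M.SatPath R p w r := by
  cases w with
  | nil => exact hR.trans _ _ _ h hw
  | cons a w =>
    obtain ⟨p₁, p₂, h₁, h₂, h₃⟩ := hw
    exact ⟨p₁, p₂, hR.trans _ _ _ h h₁, h₂, h₃⟩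

theorem IsCancelClosed.satPath_append (hR : M.IsCancelClosed R) {p q : σ}
    {u v : List (α × Bool)} :
    M.SatPath R p (u ++ v) q ↔ ∃ r, M.SatPath R p u r ∧ M.SatPath R r v q := by
  induction u generalizing p with
  | nil =>
    exact ⟨fun h => ⟨p, hR.refl p, h⟩, fun ⟨r, h₁, h₂⟩ => hR.satPath_of_rel h₁ h₂⟩
  | cons a u ih =>
    simp only [List.cons_append, SatPath, ih]
    constructor
    · rintro ⟨p₁, p₂, h₁, h₂, r, h₃, h₄⟩
      exact ⟨r, ⟨p₁, p₂, h₁, h₂, h₃⟩, h₄⟩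
    · rintro ⟨r, ⟨p₁, p₂, h₁, h₂, h₃⟩, h₄⟩
      exact ⟨p₁, p₂, h₁, h₂, r, h₃, h₄⟩

/-- Around a deleted factor `a a⁻¹` the path has the form `R`, `a`, `R`, `a⁻¹`. The letter rule
turns the last three into one `R`-step, transitivity merges it with the first, and the result is
absorbed by the `R`-step that begins the rest of the path. -/
theorem IsCancelClosed.satPath_of_red (hR : M.IsCancelClosed R) {p q : σ}
    {u v : List (α × Bool)} (h : FreeGroup.Red u v) (hu : M.SatPath R p u q) :
    M.SatPath R p v q := by
  induction h with
  | refl => exact hu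
  | tail _ hs ih =>
    cases hs with
    | @not L₁ L₂ x b =>
      obtain ⟨r, h₁, p₁, p₂, h₂, h₃, p₃, p₄, h₄, h₅, h₆⟩ := hR.satPath_append.1 ih
      exact hR.satPath_append.2 ⟨r, h₁, hR.satPath_of_rel
        (hR.trans _ _ _ h₂ (hR.letter (x, b) _ _ _ _ h₃ h₄ h₅)) h₆⟩

theorem IsCancelClosed.satPath_of_isPath (hR : M.IsCancelClosed R) {p q : σ}
    {x : List (Option (α × Bool))} (h : M.IsPath p q x) : M.SatPath R p x.reduceOption q := by
  induction h with
  | nil s => exact hR.refl s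
  | cons t s u a x hs _ ih =>
    cases a with
    | none => exact hR.satPath_of_rel (hR.eps _ _ hs) ih
    | some a => exact ⟨s, t, hR.refl s, hs, ih⟩

/-- Replacing each `R`-step by a path with trivial word does not change the element of the free
group. -/
theorem SatPath.exists_isPath (hR : ∀ p q, R p q → M.Cancels p q) {p q : σ}
    {u : List (α × Bool)} (h : M.SatPath R p u q) :
    ∃ x, M.IsPath p q x ∧ FreeGroup.mk x.reduceOption = FreeGroup.mk u := by
  induction u generalizing p with
  | nil => exact hR p q h
  | cons a u ih =>
    obtain ⟨p₁, p₂, h₁, h₂, h₃⟩ := h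
    obtain ⟨x, hx, hx'⟩ := hR _ _ h₁
    obtain ⟨y, hy, hy'⟩ := ih h₃
    refine ⟨x ++ some a :: y, M.isPath_append.2 ⟨p₁, hx, .cons _ _ _ _ _ h₂ hy⟩, ?_⟩
    rw [List.reduceOption_append, ← FreeGroup.mul_mk, hx', one_mul,
      List.reduceOption_cons_of_some, ← List.singleton_append, ← FreeGroup.mul_mk, hy',
      FreeGroup.mul_mk, List.singleton_append]

theorem IsCancelClosed.exists_isPath_reduce_iff [DecidableEq α] (hR : M.IsCancelClosed R)
    (hR' : ∀ p q, R p q → M.Cancels p q) {p q : σ} {u : List (α × Bool)} :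
    (∃ x, M.IsPath p q x ∧ FreeGroup.reduce x.reduceOption = u) ↔
      FreeGroup.IsReduced u ∧ M.SatPath R p u q := by
  constructor
  · rintro ⟨x, hx, rfl⟩
    exact ⟨FreeGroup.isReduced_iff_reduce_eq.2 FreeGroup.reduce.idem,
      hR.satPath_of_red FreeGroup.reduce.red (hR.satPath_of_isPath hx)⟩
  · rintro ⟨hu, h⟩
    obtain ⟨x, hx, hx'⟩ := h.exists_isPath hR'
    exact ⟨x, hx, (FreeGroup.reduce.sound hx').trans hu.reduce_eq⟩

/-- The automaton whose states are, up to the equivalence `e`, the states of `M` together with the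
last letter read, if any. It has the `ε`-transitions given by `R`, and reads only reduced words. -/
def reducedNFA (M : εNFA (α × Bool) σ) (R : σ → σ → Prop) (e : σ × Option (α × Bool) ≃ τ)
    (q₀ : σ) : εNFA (α × Bool) τ where
  step x
    | none => {y | (e.symm x).2 = (e.symm y).2 ∧ R (e.symm x).1 (e.symm y).1}
    | some a => {y | (e.symm y).2 = some a ∧ (e.symm x).2 ≠ some (a.1, !a.2) ∧
        (e.symm y).1 ∈ M.step (e.symm x).1 (some a)}
  start := {e (q₀, none)}
  accept := {x | (e.symm x).1 ∈ M.accept}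

/-- The word `u` can be read after the letter `c` without creating a cancelling factor. -/
def ReducedAfter (c : Option (α × Bool)) (u : List (α × Bool)) : Prop :=
  FreeGroup.IsReduced u ∧ ∀ a ∈ u.head?, c ≠ some (a.1, !a.2)

theorem reducedAfter_cons {c : Option (α × Bool)} {a : α × Bool} {u : List (α × Bool)} :
    ReducedAfter c (a :: u) ↔ c ≠ some (a.1, !a.2) ∧ ReducedAfter (some a) u := by
  cases u with
  | nil => simp [ReducedAfter]
  | cons b u =>
    obtain ⟨i, x⟩ := a
    obtain ⟨j, y⟩ := b
    simp only [ReducedAfter, FreeGroup.isReduced_cons_cons, List.head?_cons, Option.mem_some_iff,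
      forall_eq', ne_eq, Option.some.injEq, Prod.mk.injEq, not_and, Bool.eq_not]
    tauto

theorem IsCancelClosed.satPath_of_isPath_reducedNFA (hR : M.IsCancelClosed R)
    {e : σ × Option (α × Bool) ≃ τ} {q₀ : σ} {p q : τ} {x : List (Option (α × Bool))}
    (h : (M.reducedNFA R e q₀).IsPath p q x) :
    ReducedAfter (e.symm p).2 x.reduceOption ∧
      M.SatPath R (e.symm p).1 x.reduceOption (e.symm q).1 := by
  induction h with
  | nil s => exact ⟨by simp [ReducedAfter], hR.refl _⟩
  | cons t s u a x hs _ ih =>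
    cases a with
    | none =>
      obtain ⟨h₁, h₂⟩ := hs
      rw [List.reduceOption_cons_of_none, h₁]
      exact ⟨ih.1, hR.satPath_of_rel h₂ ih.2⟩
    | some a =>
      obtain ⟨h₁, h₂, h₃⟩ := hs
      rw [List.reduceOption_cons_of_some, reducedAfter_cons]
      rw [h₁] at ih
      exact ⟨⟨h₂, ih.1⟩, _, _, hR.refl _, h₃, ih.2⟩

theorem SatPath.exists_isPath_reducedNFA (e : σ × Option (α × Bool) ≃ τ) (q₀ : σ) {p q : σ}
    {u : List (α × Bool)} (h : M.SatPath R p u q) {c : Option (α × Bool)}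
    (hc : ReducedAfter c u) :
    ∃ d x, (M.reducedNFA R e q₀).IsPath (e (p, c)) (e (q, d)) x ∧ x.reduceOption = u := by
  induction u generalizing p c with
  | nil =>
    have h : R p q := h
    exact ⟨c, [none], IsPath.singleton _ (by simpa [reducedNFA] using h), rfl⟩
  | cons a u ih =>
    obtain ⟨p₁, p₂, h₁, h₂, h₃⟩ := h
    rw [reducedAfter_cons] at hc
    obtain ⟨d, x, hx, hx'⟩ := ih h₃ hc.2
    refine ⟨d, none :: some a :: x, .cons (e (p₁, c)) _ _ _ _ ?_
      (.cons (e (p₂, some a)) _ _ _ _ ?_ hx), by simp [hx']⟩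
    · simpa [reducedNFA] using h₁
    · simpa [reducedNFA] using ⟨hc.1, h₂⟩

/-- The initial state remembers no letter, and `ReducedAfter none u` only says that `u` is reduced.
So both sides come down to a reduced word with a `SatPath` from `q₀` to an accepting state. -/
theorem IsCancelClosed.accepts_reducedNFA {k : ℕ} {M : εNFA (Letter k) σ} {R : σ → σ → Prop}
    (hR : M.IsCancelClosed R) (hR' : ∀ p q, R p q → M.Cancels p q)
    (e : σ × Option (Letter k) ≃ τ) {q₀ : σ} (hq₀ : M.start = {q₀}) :
    (M.reducedNFA R e q₀).accepts = reducedLanguage M.accepts := by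
  ext u
  have h₁ : u ∈ reducedLanguage M.accepts ↔ ∃ q ∈ M.accept, ∃ x, M.IsPath q₀ q x ∧
      FreeGroup.reduce x.reduceOption = u := by
    constructor
    · rintro ⟨w, hw, hu⟩
      obtain ⟨s₁, s₂, x, h₁, h₂, rfl, h₄⟩ := M.mem_accepts_iff_exists_path.1 hw
      rw [hq₀, Set.mem_singleton_iff] at h₁
      exact ⟨s₂, h₂, x, h₁ ▸ h₄, hu⟩
    · rintro ⟨q, hq, x, hx, hu⟩
      exact ⟨_, M.mem_accepts_iff_exists_path.2 ⟨q₀, q, x, by simp [hq₀], hq, rfl, hx⟩, hu⟩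
  rw [h₁, mem_accepts_iff_exists_path]
  simp only [hR.exists_isPath_reduce_iff hR']
  constructor
  · rintro ⟨s₁, s₂, x, hs₁, hs₂, rfl, h⟩
    obtain rfl : s₁ = e (q₀, none) := hs₁
    have := hR.satPath_of_isPath_reducedNFA h
    simp only [Equiv.symm_apply_apply] at this
    exact ⟨_, hs₂, this.1.1, this.2⟩
  · rintro ⟨q, hq, hu, h⟩
    obtain ⟨d, x, hx, hx'⟩ := h.exists_isPath_reducedNFA e q₀ (c := none) ⟨hu, by simp⟩
    exact ⟨_, _, x, rfl, by simpa [reducedNFA] using hq, hx', hx⟩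

end εNFA

/-! ## Numbering of letters and states -/

theorem labelCode_lt {k : ℕ} (l : Option (Letter k)) : labelCode l < 2 * k + 1 := by
  rcases l with _ | ⟨i, b⟩
  · simp [labelCode]
  · have := i.2
    cases b <;> simp only [labelCode, Bool.toNat_true, Bool.toNat_false] <;> omega

theorem labelCode_injective {k : ℕ} : Function.Injective (labelCode (k := k)) := by
  rintro (_ | ⟨i, b⟩) (_ | ⟨j, c⟩) h
  · rfl
  · simp only [labelCode] at h; omega
  · simp only [labelCode] at h; omega
  · have : (i : ℕ) = j ∧ b = c := by
      cases b <;> cases c <;>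
        simp only [labelCode, Bool.toNat_true, Bool.toNat_false] at h <;>
        first | omega | exact ⟨by omega, rfl⟩
    rw [Fin.ext this.1, this.2]

/-- The code of the inverse of the letter with code `c`. -/
def invCode (c : ℕ) : ℕ := c + 2 * (c - c / 2 * 2) - 1

/-- Inverse letters have odd codes and letters of `Γ` the even codes that follow them. Inversion
thus adds `1` to an odd code and subtracts `1` from a positive even one. -/
theorem labelCode_inv {k : ℕ} (a : Letter k) :
    labelCode (some ((a.1, !a.2) : Letter k)) = invCode (labelCode (some a)) := by
  obtain ⟨i, b⟩ := a
  cases b <;> simp only [labelCode, invCode, Bool.not_true, Bool.not_false, Bool.toNat_true,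
    Bool.toNat_false] <;> omega

/-- Truncated subtraction makes `ε` its own inverse, so that loops over all labels need no special
case for `0`. -/
theorem invCode_zero : invCode 0 = 0 := rfl

/-- The numbering of the transition labels. -/
noncomputable def labelEquiv (k : ℕ) : Option (Letter k) ≃ Fin (2 * k + 1) :=
  Equiv.ofBijective (fun l => ⟨labelCode l, labelCode_lt l⟩) <|
    (Fintype.bijective_iff_injective_and_card _).2
      ⟨fun _ _ h => labelCode_injective (Fin.mk.inj_iff.1 h), by simp [mul_comm]⟩

theorem labelEquiv_val {k : ℕ} (l : Option (Letter k)) : (labelEquiv k l : ℕ) = labelCode l := rfl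

/-- The numbering of the pairs of a state and a label. -/
noncomputable def stateEquiv (k n : ℕ) :
    Fin n × Option (Letter k) ≃ Fin ((2 * k + 1) * n) :=
  ((Equiv.prodComm _ _).trans ((labelEquiv k).prodCongr (Equiv.refl _))).trans finProdFinEquiv

theorem stateEquiv_val {k n : ℕ} (p : Fin n) (c : Option (Letter k)) :
    (stateEquiv k n (p, c) : ℕ) = p + n * labelCode c := rfl

theorem stateEquiv_symm_fst {k n : ℕ} (x : Fin ((2 * k + 1) * n)) :
    (((stateEquiv k n).symm x).1 : ℕ) = x % n := by
  obtain ⟨⟨p, c⟩, rfl⟩ := (stateEquiv k n).surjective x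
  rw [Equiv.symm_apply_apply, stateEquiv_val, Nat.add_mul_mod_self_left, Nat.mod_eq_of_lt p.2]

theorem labelCode_stateEquiv_symm_snd {k n : ℕ} (x : Fin ((2 * k + 1) * n)) :
    labelCode ((stateEquiv k n).symm x).2 = x / n := by
  obtain ⟨⟨p, c⟩, rfl⟩ := (stateEquiv k n).surjective x
  rw [Equiv.symm_apply_apply, stateEquiv_val, Nat.add_mul_div_left _ _ (p.pos),
    Nat.div_eq_of_lt p.2, zero_add]

/-! ## A program logic for the random access machine -/

namespace RAM

@[simp] theorem Store.setVar_var (s : Store) (x v y : ℕ) :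
    (s.setVar x v).var y = if y = x then v else s.var y := by
  simp [Store.setVar, Function.update_apply]

@[simp] theorem Store.setVar_arr (s : Store) (x v : ℕ) : (s.setVar x v).arr = s.arr := rfl

@[simp] theorem Store.setArr_var (s : Store) (a i v : ℕ) : (s.setArr a i v).var = s.var := rfl

@[simp] theorem Store.setArr_arr (s : Store) (a i v b : ℕ) :
    (s.setArr a i v).arr b = if b = a then Function.update (s.arr a) i v else s.arr b := by
  simp [Store.setArr, Function.update_apply]

/-- Started in `s`, the program halts after at most `T` steps in a store that satisfies `Q`. -/
def WP (B : ℕ) (P : Prog) (T : ℕ) (Q : Store → Prop) (s : Store) : Prop :=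
  ∃ t s', Runs B P s t s' ∧ t ≤ T ∧ Q s'

variable {B T : ℕ} {P P' : Prog} {Q Q' : Store → Prop} {s : Store} {e i : Expr} {x a u v : ℕ}

theorem WP.mono {T' : ℕ} (h : WP B P T Q s) (hT : T ≤ T') (hQ : ∀ s, Q s → Q' s) :
    WP B P T' Q' s := by
  obtain ⟨t, s', h₁, h₂, h₃⟩ := h
  exact ⟨t, s', h₁, h₂.trans hT, hQ _ h₃⟩

theorem WP.seq {T' : ℕ} (h : WP B P T Q s) (h' : ∀ s, Q s → WP B P' T' Q' s) :
    WP B (.seq P P') (T + T') Q' s := by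
  obtain ⟨t, s₁, h₁, h₂, h₃⟩ := h
  obtain ⟨t', s₂, h₄, h₅, h₆⟩ := h' s₁ h₃
  exact ⟨_, s₂, .seq h₁ h₄, Nat.add_le_add h₂ h₅, h₆⟩

theorem WP.skip (hT : 1 ≤ T) (h : Q s) : WP B .skip T Q s := ⟨1, s, .skip s, hT, h⟩

theorem WP.assign (hT : e.cost + 1 ≤ T) (hf : e.Fits B s) (hv : e.eval s = v)
    (h : Q (s.setVar x v)) : WP B (.assign x e) T Q s :=
  ⟨_, _, .assign s x e hf, hT, hv ▸ h⟩

/-- The time budget is consumed from the front by subtraction, exact because of `hT`. With a numeral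
as budget, the side conditions on time in straight-line code are decidable. -/
theorem WP.assign_seq (hT : e.cost + 1 ≤ T) (hf : e.Fits B s) (hv : e.eval s = v)
    (h : WP B P (T - (e.cost + 1)) Q (s.setVar x v)) :
    WP B (.seq (.assign x e) P) T Q s :=
  ((WP.assign (Q := fun s' => s' = s.setVar x v) le_rfl hf hv rfl).seq
    (fun _ hs => hs ▸ h)).mono (by omega) fun _ => id

theorem WP.write (hT : i.cost + e.cost + 1 ≤ T) (hi : i.Fits B s) (hf : e.Fits B s)
    (hu : i.eval s = u) (hv : e.eval s = v) (h : Q (s.setArr a u v)) :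
    WP B (.write a i e) T Q s :=
  ⟨_, _, .write s a i e hi hf, hT, hu ▸ hv ▸ h⟩

theorem WP.write_seq (hT : i.cost + e.cost + 1 ≤ T) (hi : i.Fits B s) (hf : e.Fits B s)
    (hu : i.eval s = u) (hv : e.eval s = v)
    (h : WP B P (T - (i.cost + e.cost + 1)) Q (s.setArr a u v)) :
    WP B (.seq (.write a i e) P) T Q s :=
  ((WP.write (Q := fun s' => s' = s.setArr a u v) le_rfl hi hf hu hv rfl).seq
    (fun _ hs => hs ▸ h)).mono (by omega) fun _ => id

theorem WP.ite (hT : e.cost + 1 ≤ T) (hf : e.Fits B s)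
    (h : e.eval s ≠ 0 → WP B P (T - (e.cost + 1)) Q s)
    (h' : e.eval s = 0 → WP B P' (T - (e.cost + 1)) Q s) : WP B (.ite e P P') T Q s := by
  by_cases he : e.eval s = 0
  · obtain ⟨t, s', h₁, h₂, h₃⟩ := h' he
    exact ⟨_, s', .ite_false P hf he h₁, by omega, h₃⟩
  · obtain ⟨t, s', h₁, h₂, h₃⟩ := h he
    exact ⟨_, s', .ite_true P' hf he h₁, by omega, h₃⟩

/-- Repeat the body for the values `0, 1, …` of variable `i` below the value of variable `N`. -/
def Prog.loop (i N : ℕ) (body : Prog) : Prog :=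
  .seq (.assign i (.lit 0)) (.while (.sub (.var N) (.var i))
    (.seq body (.assign i (.add (.var i) (.lit 1)))))

/-- Each iteration pays `4` for the test and `4` for the increment on top of the body; the failing
test at the end and the initial assignment add `4 + 2`. The invariant is required after the
increment, so it has to survive the change of the loop variable. -/
theorem WP.loop {i N b : ℕ} {body : Prog} {Inv : ℕ → Store → Prop} (hb : b < B)
    (hN : ∀ j s, Inv j s → s.var N = b) (h₀ : Inv 0 (s.setVar i 0))
    (hbody : ∀ j < b, ∀ s, Inv j s → s.var i = j →
      WP B body T (fun s' => s'.var i = j ∧ Inv (j + 1) (s'.setVar i (j + 1))) s) :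
    WP B (.loop i N body) (b * (T + 8) + 6) (Inv b) s := by
  have key : ∀ r j s, j + r = b → Inv j s → s.var i = j →
      WP B (.while (.sub (.var N) (.var i)) (.seq body (.assign i (.add (.var i) (.lit 1)))))
        (r * (T + 8) + 4) (Inv b) s := by
    intro r
    induction r with
    | zero =>
      intro j s hj hs hi
      have hN := hN _ _ hs
      refine ⟨_, s, .while_false _ ?_ ?_, ?_, ?_⟩
      · simp only [Expr.Fits, hN, hi]; omega
      · simp only [Expr.eval, hN, hi]; omega
      · simp [Expr.cost]
      · rwa [← hj, add_zero]
    | succ r ih =>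
      intro j s hj hs hi
      have hN := hN _ _ hs
      obtain ⟨t, s₁, h₁, h₂, h₃, h₄⟩ := hbody j (by omega) s hs hi
      obtain ⟨t', s₂, h₅, h₆, h₇⟩ := ih (j + 1) (s₁.setVar i (j + 1)) (by omega) h₄ (by simp)
      have inc : Runs B (.assign i (.add (.var i) (.lit 1))) s₁ 4 (s₁.setVar i (j + 1)) := by
        have := Runs.assign (B := B) s₁ i (.add (.var i) (.lit 1))
          (by simp only [Expr.Fits, Expr.eval, h₃]; omega)
        simp only [Expr.eval, h₃] at this
        exact this
      refine ⟨_, s₂, .while_true ?_ ?_ (.seq h₁ inc) h₅, ?_, h₇⟩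
      rotate_left 2
      · simp only [Expr.cost, Nat.add_mul]; omega
      · simp only [Expr.Fits, hN, hi]; omega
      · simp only [Expr.eval, hN, hi]; omega
  refine (WP.assign_seq (T := b * (T + 8) + 6) (v := 0) (by simp [Expr.cost]) (Nat.zero_le _)
    rfl ((key b 0 _ (by omega) h₀ (by simp)).mono ?_ fun _ => id))
  simp [Expr.cost]

end RAM

/-! ## Saturation of a relation by marking -/

/-- The relation `S` on `0, …, n - 1` is reflexive and transitive, contains the transitions with
label `0` of the table `D`, and can be extended by a label on the left and its inverse on the
right. -/
structure TableClosed (n K : ℕ) (D : ℕ → ℕ) (S : ℕ → ℕ → Prop) : Prop where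
  refl : ∀ p < n, S p p
  trans : ∀ p < n, ∀ q < n, ∀ r < n, S p q → S q r → S p r
  eps : ∀ p < n, ∀ q < n, D (p * K * n + q) ≠ 0 → S p q
  label : ∀ l < K, ∀ p < n, ∀ p' < n, ∀ q' < n, ∀ q < n, S p' q' →
    D ((p * K + l) * n + p') ≠ 0 → D ((q' * K + invCode l) * n + q) ≠ 0 → S p q

/-- The state of the saturation after `j` rounds: in the array `A`, the pairs that have been found
are marked `1`, and `2` if their consequences have been found, too. -/
structure SatInv (n K : ℕ) (D : ℕ → ℕ) (S : ℕ → ℕ → Prop) (j : ℕ) (A : ℕ → ℕ) : Prop where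
  le_two : ∀ x < n * n, A x ≤ 2
  sound : ∀ x < n * n, A x ≠ 0 → S (x / n) (x % n)
  refl : ∀ p < n, A (p * n + p) ≠ 0
  eps : ∀ p < n, ∀ q < n, D (p * K * n + q) ≠ 0 → A (p * n + q) ≠ 0
  trans : ∀ p < n, ∀ q < n, ∀ r < n, A (p * n + q) = 2 → A (q * n + r) = 2 → A (p * n + r) ≠ 0
  label : ∀ l < K, ∀ p < n, ∀ p' < n, ∀ q' < n, ∀ q < n, A (p' * n + q') = 2 →
    D ((p * K + l) * n + p') ≠ 0 → D ((q' * K + invCode l) * n + q) ≠ 0 → A (p * n + q) ≠ 0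
  count : (∃ x < n * n, A x = 1) → j ≤ ((Finset.range (n * n)).filter (A · = 2)).card

/-- The array `A'` arises from `A` by marking new pairs of `S`. -/
def Extends (n : ℕ) (S : ℕ → ℕ → Prop) (A A' : ℕ → ℕ) : Prop :=
  ∀ x < n * n, A' x = A x ∨ A x = 0 ∧ A' x = 1 ∧ S (x / n) (x % n)

/-- The pair `(p, q)` is a consequence of the pair `(p', q')`. -/
def Fires (n K : ℕ) (D A : ℕ → ℕ) (p' q' l p q : ℕ) : Prop :=
  A (p * n + p') ≠ 0 ∧ A (q' * n + q) ≠ 0 ∨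
    D ((p * K + l) * n + p') ≠ 0 ∧ D ((q' * K + invCode l) * n + q) ≠ 0

theorem mul_add_lt_mul {p a q b : ℕ} (hp : p < a) (hq : q < b) : p * b + q < a * b :=
  calc p * b + q < p * b + b := Nat.add_lt_add_left hq _
    _ = (p + 1) * b := by ring
    _ ≤ a * b := Nat.mul_le_mul_right _ hp

theorem mul_add_div_eq {p q b : ℕ} (hq : q < b) : (p * b + q) / b = p := by
  rw [Nat.add_comm, Nat.add_mul_div_right _ _ (by omega), Nat.div_eq_of_lt hq, zero_add]

theorem mul_add_mod_eq {p q b : ℕ} (hq : q < b) : (p * b + q) % b = q := by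
  rw [Nat.mul_add_mod_self_right, Nat.mod_eq_of_lt hq]

/-- The entries `2` of `A'` are the old ones and `y`. A consequence of old ones alone is already
marked in `A`, and one that involves `y` is marked by `hF`. As `y` is set to `2` before its
consequences are collected, combinations of `y` with itself are covered. -/
theorem SatInv.next {n K j : ℕ} {D A A' : ℕ → ℕ} {S : ℕ → ℕ → Prop} (h : SatInv n K D S j A)
    {p' q' : ℕ} (hp' : p' < n) (hq' : q' < n) (hK : 0 < K) (h₁ : A (p' * n + q') = 1)
    (hA' : Extends n S (Function.update A (p' * n + q') 2) A')
    (hF : ∀ l < K, ∀ p < n, ∀ q < n,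
      Fires n K D (Function.update A (p' * n + q') 2) p' q' l p q → A' (p * n + q) ≠ 0) :
    SatInv n K D S (j + 1) A' := by
  set y := p' * n + q' with hy
  have hyn : y < n * n := mul_add_lt_mul hp' hq'
  have hy2 : A' y = 2 := by simpa using hA' y hyn
  have hne : ∀ x < n * n, x ≠ y → A' x = A x ∨ A x = 0 ∧ A' x = 1 ∧ S (x / n) (x % n) := by
    intro x hx hxy
    simpa [Function.update_of_ne hxy] using hA' x hx
  have hup : ∀ x < n * n, A x ≠ 0 → A' x ≠ 0 := by
    intro x hx hx'
    by_cases hxy : x = y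
    · rw [hxy, hy2]; simp
    · rcases hne x hx hxy with h | h <;> omega
  have hupd : ∀ x < n * n, A x ≠ 0 → Function.update A y 2 x ≠ 0 := by
    intro x hx hx'
    by_cases hxy : x = y
    · simp [hxy]
    · rwa [Function.update_of_ne hxy]
  have htwo : ∀ x < n * n, A' x = 2 → x = y ∨ A x = 2 := by
    intro x hx hx'
    by_cases hxy : x = y
    · exact .inl hxy
    · rcases hne x hx hxy with h | h <;> right <;> omega
  have htwo' : ∀ x < n * n, A' x = 2 → A x ≠ 0 := by
    intro x hx hx'
    rcases htwo x hx hx' with rfl | h <;> omega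
  refine ⟨?_, ?_, ?_, ?_, ?_, ?_, ?_⟩
  · intro x hx
    by_cases hxy : x = y
    · rw [hxy, hy2]
    · have := h.le_two x hx
      rcases hne x hx hxy with h | h <;> omega
  · intro x hx hx'
    by_cases hxy : x = y
    · rw [hxy]; exact h.sound y hyn (by omega)
    · rcases hne x hx hxy with h' | h'
      · exact h.sound x hx (by omega)
      · exact h'.2.2
  · exact fun p hp => hup _ (mul_add_lt_mul hp hp) (h.refl p hp)
  · exact fun p hp q hq hD => hup _ (mul_add_lt_mul hp hq) (h.eps p hp q hq hD)
  · intro p hp q hq r hr hpq hqr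
    have hpq' := mul_add_lt_mul hp hq
    have hqr' := mul_add_lt_mul hq hr
    have h₂ := htwo' _ hpq' hpq
    have h₃ := htwo' _ hqr' hqr
    have inj : ∀ {a b : ℕ}, b < n → a * n + b = y → a = p' ∧ b = q' := by
      intro a b hb hab
      constructor
      · rw [← mul_add_div_eq (p := a) hb, hab, hy, mul_add_div_eq hq']
      · rw [← mul_add_mod_eq (p := a) hb, hab, hy, mul_add_mod_eq hq']
    rcases htwo _ hpq' hpq with e | e
    · obtain ⟨rfl, rfl⟩ := inj hq e
      -- The transitivity alternative of `Fires` does not depend on the label, so label `0` serves.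
      -- `Fires` composes on both sides at once; the pair `(p, p)` fills the side where nothing is
      -- to be added.
      exact hF 0 hK _ hp _ hr (.inl ⟨hupd _ (mul_add_lt_mul hp hp) (h.refl p hp),
        hupd _ hqr' h₃⟩)
    · rcases htwo _ hqr' hqr with e' | e'
      · obtain ⟨rfl, rfl⟩ := inj hr e'
        exact hF 0 hK _ hp _ hr (.inl ⟨hupd _ hpq' h₂, hupd _ (mul_add_lt_mul hr hr) (h.refl r hr)⟩)
      · exact hup _ (mul_add_lt_mul hp hr) (h.trans p hp q hq r hr e e')
  · intro l hl p hp a ha b hb q hq h2 hD hD'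
    rcases htwo _ (mul_add_lt_mul ha hb) h2 with e | e
    · have ha' : a = p' := by rw [← mul_add_div_eq (p := a) hb, e, hy, mul_add_div_eq hq']
      have hb' : b = q' := by rw [← mul_add_mod_eq (p := a) hb, e, hy, mul_add_mod_eq hq']
      exact hF l hl p hp q hq (.inr ⟨ha' ▸ hD, hb' ▸ hD'⟩)
    · exact hup _ (mul_add_lt_mul hp hq) (h.label l hl p hp a ha b hb q hq e hD hD')
  · intro _
    refine (Nat.add_le_add_right (h.count ⟨y, hyn, h₁⟩) 1).trans ?_
    rw [← Finset.card_insert_of_notMem (a := y) (by simp [h₁])]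
    refine Finset.card_le_card fun x hx => ?_
    rw [Finset.mem_insert, Finset.mem_filter, Finset.mem_range] at hx
    rw [Finset.mem_filter, Finset.mem_range]
    rcases hx with rfl | ⟨hx, hx2⟩
    · exact ⟨hyn, hy2⟩
    · refine ⟨hx, ?_⟩
      rcases hne x hx (by rintro rfl; omega) with h | h <;> omega

/-- Once no entry is `1`, the lower bound on the number of `2`s is vacuous, so idle rounds are
harmless and the number of rounds can be fixed in advance. -/
theorem SatInv.skip {n K j : ℕ} {D A : ℕ → ℕ} {S : ℕ → ℕ → Prop} (h : SatInv n K D S j A)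
    (h₁ : ∀ x < n * n, A x ≠ 1) (j' : ℕ) : SatInv n K D S j' A :=
  { h with count := fun ⟨x, hx, hx'⟩ => (h₁ x hx hx').elim }

/-- If a `1` were left after `n²` rounds, there would be `n²` entries `2` besides it, too many for
`n²` places. So every marked pair has been processed, and the rules for `2` hold for all marked
pairs. -/
theorem SatInv.tableClosed {n K : ℕ} {D A : ℕ → ℕ} {S : ℕ → ℕ → Prop}
    (h : SatInv n K D S (n * n) A) : TableClosed n K D fun p q => A (p * n + q) ≠ 0 := by
  have h₁ : ∀ x < n * n, A x ≠ 0 → A x = 2 := by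
    intro x hx hx'
    by_contra hx2
    have h1 : A x = 1 := by have := h.le_two x hx; omega
    have hc := h.count ⟨x, hx, h1⟩
    have hlt : ((Finset.range (n * n)).filter (A · = 2)).card < (Finset.range (n * n)).card :=
      Finset.card_lt_card (Finset.filter_ssubset.2 ⟨x, Finset.mem_range.2 hx, hx2⟩)
    rw [Finset.card_range] at hlt
    omega
  exact ⟨h.refl, fun p hp q hq r hr h₂ h₃ => h.trans p hp q hq r hr
      (h₁ _ (mul_add_lt_mul hp hq) h₂) (h₁ _ (mul_add_lt_mul hq hr) h₃), h.eps,
    fun l hl p hp p' hp' q' hq' q hq h₂ => h.label l hl p hp p' hp' q' hq' q hq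
      (h₁ _ (mul_add_lt_mul hp' hq') h₂)⟩

/-! ## The program -/

namespace RAM

variable {B n k K q₀ : ℕ} {D F A : ℕ → ℕ} {s : Store}

/-- The remainder of `e` modulo `f`. -/
def Expr.mod (e f : Expr) : Expr := .sub e (.mul (.div e f) f)

/-- The value `1` if `x` and `y` have the same value, and `0` otherwise. -/
def Expr.eq (x y : ℕ) : Expr :=
  .sub (.lit 1) (.add (.sub (.var x) (.var y)) (.sub (.var y) (.var x)))

/-- The code of the inverse of the letter in variable `l`. -/
def Expr.inv (l : ℕ) : Expr :=
  .sub (.add (.var l) (.mul (.lit 2) (.mod (.var l) (.lit 2)))) (.lit 1)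

/-- The index of the pair `(p, q)` of states in variables. -/
def Expr.pair (p q : ℕ) : Expr := .add (.mul (.var p) (.var 0)) (.var q)

/-- The index of the transition from `p` to `q` with label `l` in the table. -/
def Expr.trans (p l q : ℕ) : Expr :=
  .add (.mul (.add (.mul (.var p) (.var 5)) (.var l)) (.var 0)) (.var q)

@[simp] theorem Expr.eval_mod (e f : Expr) : (e.mod f).eval s = e.eval s % f.eval s := by
  simp only [Expr.mod, Expr.eval]
  rw [mul_comm, ← Nat.mod_eq_sub_mul_div]

-- With truncated subtraction, `(x - y) + (y - x)` is the distance of `x` and `y`, and `1` minus it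
-- vanishes unless they agree.
@[simp] theorem Expr.eval_eq (x y : ℕ) :
    (Expr.eq x y).eval s = if s.var x = s.var y then 1 else 0 := by
  simp only [Expr.eq, Expr.eval]
  split_ifs <;> omega

@[simp] theorem Expr.eval_inv (l : ℕ) : (Expr.inv l).eval s = invCode (s.var l) := by
  simp only [Expr.inv, Expr.eval, Expr.eval_mod, invCode]
  omega

@[simp] theorem Expr.eval_pair (p q : ℕ) :
    (Expr.pair p q).eval s = s.var p * s.var 0 + s.var q := rfl

@[simp] theorem Expr.eval_trans (p l q : ℕ) :
    (Expr.trans p l q).eval s = (s.var p * s.var 5 + s.var l) * s.var 0 + s.var q := rfl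

theorem Expr.fits_mod {e f : Expr} (he : e.Fits B s) (hf : f.Fits B s) (h : e.eval s ≤ B) :
    (e.mod f).Fits B s :=
  ⟨he, ⟨he, hf⟩, hf, (Nat.div_mul_le_self _ _).trans h⟩

theorem Expr.fits_eq {x y : ℕ} (hB : 1 ≤ B) (hx : s.var x ≤ B) (hy : s.var y ≤ B) :
    (Expr.eq x y).Fits B s := by
  refine ⟨hB, ⟨hx, hy⟩, ⟨hy, hx⟩, ?_⟩
  simp only [Expr.eval]
  omega

theorem Expr.fits_inv {l : ℕ} (hl : s.var l + 2 ≤ B) : (Expr.inv l).Fits B s := by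
  have h : s.var l % 2 < 2 := Nat.mod_lt _ (by omega)
  refine ⟨⟨?_, ⟨?_, Expr.fits_mod ?_ ?_ ?_, ?_⟩, ?_⟩, ?_⟩ <;>
    simp only [Expr.Fits, Expr.eval, Expr.eval_mod] <;> omega

theorem Expr.fits_pair {p q a b : ℕ} (hp : s.var p < a) (hq : s.var q < b) (h : s.var 0 = b)
    (hB : a * b ≤ B) : (Expr.pair p q).Fits B s := by
  have hlt := mul_add_lt_mul hp hq
  have hb : 0 < b := by omega
  have h₁ := Nat.le_mul_of_pos_right (s.var p) hb
  have h₂ := Nat.le_mul_of_pos_left b (show 0 < a by omega)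
  refine ⟨⟨?_, ?_, ?_⟩, ?_, ?_⟩ <;> simp only [Expr.Fits, Expr.eval, h] <;> omega

theorem Expr.fits_trans {p l q : ℕ} (hp : s.var p < n) (hl : s.var l < K) (hq : s.var q < n)
    (h : s.var 0 = n) (h5 : s.var 5 = K) (hB : n * K * n ≤ B) : (Expr.trans p l q).Fits B s := by
  have h₁ := mul_add_lt_mul hp hl
  have h₂ := mul_add_lt_mul h₁ hq
  have h₃ := Nat.le_mul_of_pos_right (s.var p) (show 0 < K by omega)
  have h₄ := Nat.le_mul_of_pos_right (s.var p * K + s.var l) (show 0 < n by omega)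
  have h₅ := Nat.le_mul_of_pos_left K (show 0 < n by omega)
  have h₆ := Nat.le_mul_of_pos_left n (show 0 < n * K by omega)
  have h₇ := Nat.le_mul_of_pos_right (n * K) (show 0 < n by omega)
  refine ⟨⟨⟨⟨?_, ?_, ?_⟩, ?_, ?_⟩, ?_, ?_⟩, ?_, ?_⟩ <;>
    simp only [Expr.Fits, Expr.eval, h, h5] <;> omega

/-- The input and the sizes that the program computes first. -/
structure Ctx (n K q₀ : ℕ) (D F : ℕ → ℕ) (s : Store) : Prop where
  var_n : s.var 0 = n
  var_m : s.var 3 = K * n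
  var_q : s.var 4 = q₀
  var_K : s.var 5 = K
  var_N : s.var 6 = n * n
  var_NK : s.var 7 = n * n * K
  var_L : s.var 8 = K * n * K * (K * n)
  arr_D : s.arr 0 = D
  arr_F : s.arr 1 = F

/-- Variables from `9` on are scratch space, and so are the arrays from `2` on; the input tables are
never overwritten. -/
theorem Ctx.setVar (h : Ctx n K q₀ D F s) {x : ℕ} (hx : 9 ≤ x) (v : ℕ) :
    Ctx n K q₀ D F (s.setVar x v) := by
  obtain ⟨h₁, h₂, h₃, h₄, h₅, h₆, h₇, h₈, h₉⟩ := h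
  constructor <;> simp <;> first | assumption | (rw [if_neg (by omega)]; assumption)

theorem Ctx.setArr (h : Ctx n K q₀ D F s) {a : ℕ} (ha : 2 ≤ a) (i v : ℕ) :
    Ctx n K q₀ D F (s.setArr a i v) := by
  obtain ⟨h₁, h₂, h₃, h₄, h₅, h₆, h₇, h₈, h₉⟩ := h
  constructor <;> simp <;> first | assumption | (rw [if_neg (by omega)]; assumption)

/-- The numbers that occur fit into a word. -/
structure Bounds (B n k : ℕ) : Prop where
  pos : 0 < n
  le : 10 * ((2 * k + 1) ^ 3 * n ^ 2) ≤ B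

namespace Bounds

theorem mul_mul_le (h : Bounds B n k) : 10 * (n * (2 * k + 1) * n) ≤ B := by
  refine le_trans ?_ h.le
  have : (2 * k + 1) ^ 1 ≤ (2 * k + 1) ^ 3 := Nat.pow_le_pow_right (by omega) (by omega)
  calc 10 * (n * (2 * k + 1) * n) = 10 * ((2 * k + 1) ^ 1 * n ^ 2) := by ring
    _ ≤ _ := Nat.mul_le_mul_left _ (Nat.mul_le_mul_right _ this)

theorem mul_le (h : Bounds B n k) : 10 * (n * (2 * k + 1)) ≤ B := by
  have := Nat.le_mul_of_pos_right (n * (2 * k + 1)) h.pos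
  have := h.mul_mul_le
  omega

theorem sq_le (h : Bounds B n k) : 10 * (n * n) ≤ B := by
  have h₁ := h.mul_mul_le
  have h₂ := Nat.le_mul_of_pos_left (n * n) (show 0 < 2 * k + 1 by omega)
  have h₃ : n * (2 * k + 1) * n = (2 * k + 1) * (n * n) := by ring
  omega

theorem n_le (h : Bounds B n k) : 10 * n ≤ B := by
  have h₁ := h.sq_le
  have h₂ := Nat.le_mul_of_pos_left n h.pos
  omega

theorem k_le (h : Bounds B n k) : 10 * (2 * k + 1) ≤ B := by
  have h₁ := h.mul_le
  have h₂ := Nat.le_mul_of_pos_left (2 * k + 1) h.pos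
  omega

theorem table_le (h : Bounds B n k) :
    10 * ((2 * k + 1) * n * (2 * k + 1) * ((2 * k + 1) * n)) ≤ B := by
  refine le_trans (le_of_eq ?_) h.le
  ring

theorem ten_le (h : Bounds B n k) : 10 ≤ B := by
  have h₁ := h.n_le
  have := h.pos
  omega

end Bounds

/-- Mark the pairs of equal states and the `ε`-transitions in array `4`. -/
def initBody : Prog :=
  .seq (.assign 15 (.div (.var 9) (.var 0))) <|
  .seq (.assign 16 (.mod (.var 9) (.var 0))) <|
  .seq (.assign 14 (.lit 0)) <|
  .ite (.add (.eq 15 16) (.get 0 (.trans 15 14 16)))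
    (.write 4 (.var 9) (.lit 1)) (.write 4 (.var 9) (.lit 0))

/-- Memory outside the input is arbitrary at the start, which is why the zeros are written
explicitly. -/
theorem wp_init (hb : Bounds B n k) (hD : ∀ i < n * (2 * k + 1) * n, D i ≤ 1)
    (hs : Ctx n (2 * k + 1) q₀ D F s) :
    WP B (.loop 9 6 initBody) (n * n * (60 + 8) + 6)
      (fun s => Ctx n (2 * k + 1) q₀ D F s ∧ ∀ x < n * n, s.arr 4 x =
        if x / n = x % n ∨ D (x / n * (2 * k + 1) * n + x % n) ≠ 0 then 1 else 0) s := by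
  have hn := hb.n_le
  have h2 := hb.mul_mul_le
  have hsq := hb.sq_le
  have h10 := hb.ten_le
  refine WP.loop (by omega) (fun j s hs => hs.1.var_N)
    (Inv := fun j s => Ctx n (2 * k + 1) q₀ D F s ∧ ∀ x < j, s.arr 4 x =
        if x / n = x % n ∨ D (x / n * (2 * k + 1) * n + x % n) ≠ 0 then 1 else 0)
    ⟨hs.setVar le_rfl 0, by simp⟩ ?_
  rintro j hj s ⟨hs, hA⟩ hi
  have hp : j / n < n := Nat.div_lt_of_lt_mul hj
  have hq : j % n < n := Nat.mod_lt _ hb.pos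
  refine WP.assign_seq (v := j / n) (by decide) ?_ ?_ ?_
  · simp [Expr.Fits, hs.var_n, hi]; omega
  · simp [Expr.eval, hs.var_n, hi]
  refine WP.assign_seq (v := j % n) (by decide) ?_ ?_ ?_
  · apply Expr.fits_mod <;> simp [Expr.Fits, Expr.eval, hs.var_n, hi] <;> omega
  · simp [Expr.eval, hs.var_n, hi]
  refine WP.assign_seq (v := 0) (by decide) (Nat.zero_le _) rfl ?_
  have hDj := hD _ (mul_add_lt_mul (mul_add_lt_mul hp (show 0 < 2 * k + 1 by omega)) hq)
  rw [add_zero] at hDj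
  have hfin : ∀ v T, 3 ≤ T → v ≤ 1 →
      (v = if j / n = j % n ∨ D (j / n * (2 * k + 1) * n + j % n) ≠ 0 then 1 else 0) →
      WP B (.write 4 (.var 9) (.lit v)) T (fun s' => s'.var 9 = j ∧
        Ctx n (2 * k + 1) q₀ D F (s'.setVar 9 (j + 1)) ∧
        ∀ x < j + 1, (s'.setVar 9 (j + 1)).arr 4 x =
          if x / n = x % n ∨ D (x / n * (2 * k + 1) * n + x % n) ≠ 0 then 1 else 0)
        (((s.setVar 15 (j / n)).setVar 16 (j % n)).setVar 14 0) := by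
    intro v T hT hv1 hv
    refine WP.write (u := j) (v := v) hT ?_ ?_ ?_ rfl ⟨?_, ?_, ?_⟩
    · simp [Expr.Fits, hi]; omega
    · simp [Expr.Fits]; omega
    · simp [Expr.eval, hi]
    · simp [hi]
    · exact ((((hs.setVar (by omega) _).setVar (by omega) _).setVar (by omega) _).setArr
        (by omega) _ _).setVar (by omega) _
    · intro x hx
      by_cases hxj : x = j
      · simp [hxj, hv]
      · simpa [hxj] using hA x (by omega)
  refine WP.ite (by decide) ⟨?_, ⟨?_, ?_⟩, ?_⟩ (fun h => ?_) fun h => ?_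
  · apply Expr.fits_eq <;> (try simp) <;> omega
  · apply Expr.fits_trans (n := n) (K := 2 * k + 1) <;>
      (try simp [hs.var_n, hs.var_K]) <;> omega
  · simp [hs.var_n, hs.var_K, hs.arr_D]; omega
  · simp [Expr.eval, hs.var_n, hs.var_K, hs.arr_D]; split_ifs <;> omega
  · refine hfin 1 _ (by decide) le_rfl (if_pos ?_).symm
    simp [Expr.eval, hs.var_n, hs.var_K, hs.arr_D] at h
    by_cases h' : j / n = j % n <;> simp_all
  · refine hfin 0 _ (by decide) (by omega) (if_neg ?_).symm
    simp [Expr.eval, hs.var_n, hs.var_K, hs.arr_D] at h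
    simp_all

end RAM

/-! ### Saturation on the machine: choosing a pair, marking its consequences -/

namespace RAM

variable {B n k K q₀ : ℕ} {D F A : ℕ → ℕ} {s : Store}

/-- Remember in variable `11` an entry of array `4` that is `1`. -/
def pickBody : Prog :=
  .ite (.mul (.get 4 (.var 10)) (.sub (.lit 2) (.get 4 (.var 10))))
    (.assign 11 (.var 10)) .skip

/-- The product `a * (2 - a)` is nonzero only for `a = 1`. The value `n * n`, which is not an index
of a pair, stands for "nothing found". -/
theorem wp_pick (hb : Bounds B n k) {r : ℕ} (hA : ∀ x < n * n, A x ≤ 2)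
    (hs : Ctx n (2 * k + 1) q₀ D F s) (h4 : s.arr 4 = A) (h9 : s.var 9 = r)
    (h11 : s.var 11 = n * n) :
    WP B (.loop 10 6 pickBody) (n * n * (20 + 8) + 6)
      (fun s => Ctx n (2 * k + 1) q₀ D F s ∧ s.arr 4 = A ∧ s.var 9 = r ∧
        (s.var 11 = n * n ∧ (∀ x < n * n, A x ≠ 1) ∨ s.var 11 < n * n ∧ A (s.var 11) = 1)) s := by
  have hsq := hb.sq_le
  have h10 := hb.ten_le
  refine WP.loop (by omega) (fun j s hs => hs.1.var_N)
    (Inv := fun j s => Ctx n (2 * k + 1) q₀ D F s ∧ s.arr 4 = A ∧ s.var 9 = r ∧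
        (s.var 11 = n * n ∧ (∀ x < j, A x ≠ 1) ∨ s.var 11 < n * n ∧ A (s.var 11) = 1))
    ⟨hs.setVar (by omega) 0, by simpa, by simpa, by simp [h11]⟩ ?_
  rintro j hj s ⟨hs, h4, h9, h⟩ hi
  have hAj := hA j hj
  refine WP.ite (by decide) ⟨⟨?_, ?_⟩, ⟨?_, ?_, ?_⟩, ?_⟩ (fun h' => ?_) fun h' => ?_
  · simp [Expr.Fits, hi]; omega
  · simp [Expr.eval, hi, h4]; omega
  · simp [Expr.Fits]; omega
  · simp [Expr.Fits, hi]; omega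
  · simp [Expr.eval, hi, h4]; omega
  · have := Nat.mul_le_mul hAj (show 2 - A j ≤ 2 by omega)
    simp [Expr.eval, hi, h4]; omega
  · simp [Expr.eval, hi, h4] at h'
    refine WP.assign (v := j) (by decide) ?_ ?_ ⟨?_, ?_, ?_, ?_, ?_⟩
    · simp [Expr.Fits, hi]; omega
    · simp [Expr.eval, hi]
    · simp [hi]
    · exact (hs.setVar (by omega) _).setVar (by omega) _
    · simpa
    · simpa
    · right
      simp
      omega
  · simp [Expr.eval, hi, h4] at h'
    refine WP.skip (by decide) ⟨hi, hs.setVar (by omega) _, by simpa, by simpa, ?_⟩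
    simp
    rcases h with ⟨h₁, h₂⟩ | h
    · refine .inl ⟨h₁, fun x hx => ?_⟩
      by_cases hxj : x = j
      · subst hxj; omega
      · exact h₂ x (by omega)
    · exact .inr h

/-- Mark the pair of states given by the first two components of the number in variable `10` in
array `4`, if it is a consequence of the pair in variables `12, 13`, with the label that is the
third component. -/
def processBody : Prog :=
  .seq (.assign 14 (.mod (.var 10) (.var 5))) <|
  .seq (.assign 15 (.div (.var 10) (.var 5))) <|
  .seq (.assign 16 (.div (.var 15) (.var 0))) <|
  .seq (.assign 17 (.mod (.var 15) (.var 0))) <|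
  .seq (.assign 18 (.inv 14)) <|
  .ite (.mul (.add (.mul (.get 4 (.pair 16 12)) (.get 4 (.pair 13 17)))
      (.mul (.get 0 (.trans 16 14 12)) (.get 0 (.trans 13 18 17)))) (.sub (.lit 1) (.get 4 (.var 15))))
    (.write 4 (.var 15) (.lit 1)) .skip

theorem _root_.invCode_lt {k l : ℕ} (h : l < 2 * k + 1) : invCode l < 2 * k + 1 := by
  unfold invCode
  omega

theorem _root_.Extends.ne_zero {S : ℕ → ℕ → Prop} {A A' : ℕ → ℕ} (h : Extends n S A A') {x : ℕ}
    (hx : x < n * n) (hA : A x ≠ 0) : A' x ≠ 0 := by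
  rcases h x hx with h | h <;> omega

theorem _root_.Extends.sound {S : ℕ → ℕ → Prop} {A A' : ℕ → ℕ} (h : Extends n S A A')
    (hA : ∀ x < n * n, A x ≠ 0 → S (x / n) (x % n)) {p q : ℕ} (hp : p < n) (hq : q < n)
    (hx : A' (p * n + q) ≠ 0) : S p q := by
  have hpq := mul_add_lt_mul hp hq
  have key : S ((p * n + q) / n) ((p * n + q) % n) := by
    rcases h _ hpq with h | h
    · exact hA _ hpq (by omega)
    · exact h.2.2
  rwa [mul_add_div_eq hq, mul_add_mod_eq hq] at key

/-- The tests read the array while it is being changed. This is harmless: marks only grow, so every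
consequence with respect to the initial `A` is still detected, and pairs derived from marks set
meanwhile lie in `S` because `S` is closed. -/
theorem wp_process (hb : Bounds B n k) {r p' q' : ℕ} {S : ℕ → ℕ → Prop}
    (hS : TableClosed n (2 * k + 1) D S) (hD : ∀ i < n * (2 * k + 1) * n, D i ≤ 1)
    (hA : ∀ x < n * n, A x ≤ 2) (hAS : ∀ x < n * n, A x ≠ 0 → S (x / n) (x % n))
    (hp' : p' < n) (hq' : q' < n) (hpq' : S p' q')
    (hs : Ctx n (2 * k + 1) q₀ D F s) (h4 : s.arr 4 = A) (h9 : s.var 9 = r)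
    (h12 : s.var 12 = p') (h13 : s.var 13 = q') :
    WP B (.loop 10 7 processBody) (n * n * (2 * k + 1) * (120 + 8) + 6)
      (fun s => Ctx n (2 * k + 1) q₀ D F s ∧ s.var 9 = r ∧ Extends n S A (s.arr 4) ∧
        ∀ l < 2 * k + 1, ∀ p < n, ∀ q < n, Fires n (2 * k + 1) D A p' q' l p q →
          s.arr 4 (p * n + q) ≠ 0) s := by
  have hn := hb.n_le
  have hk := hb.k_le
  have h2 := hb.mul_mul_le
  have hsq := hb.sq_le
  have h10 := hb.ten_le
  have hNK : n * n * (2 * k + 1) = n * (2 * k + 1) * n := by ring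
  refine WP.mono (WP.loop (T := 120) (b := n * n * (2 * k + 1)) (by omega) (fun j s hs => hs.1.var_NK)
    (Inv := fun j s => Ctx n (2 * k + 1) q₀ D F s ∧ s.var 9 = r ∧ s.var 12 = p' ∧ s.var 13 = q' ∧
      Extends n S A (s.arr 4) ∧ ∀ z < j, Fires n (2 * k + 1) D A p' q' (z % (2 * k + 1))
        (z / (2 * k + 1) / n) (z / (2 * k + 1) % n) → s.arr 4 (z / (2 * k + 1)) ≠ 0)
    ⟨hs.setVar (by omega) 0, by simpa, by simpa, by simpa, ?_, by simp⟩ ?_) le_rfl ?_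
  · intro x _
    left
    simp [h4]
  · rintro j hj s ⟨hs, h9, h12, h13, hE, hF⟩ hi
    have hx : j / (2 * k + 1) < n * n := Nat.div_lt_of_lt_mul (by rwa [mul_comm])
    have hl : j % (2 * k + 1) < 2 * k + 1 := Nat.mod_lt _ (by omega)
    have hp : j / (2 * k + 1) / n < n := Nat.div_lt_of_lt_mul hx
    have hq : j / (2 * k + 1) % n < n := Nat.mod_lt _ hb.pos
    have hpq : j / (2 * k + 1) / n * n + j / (2 * k + 1) % n = j / (2 * k + 1) :=
      Nat.div_add_mod' _ _
    have hF' : ∀ z < j + 1, z ≠ j → Fires n (2 * k + 1) D A p' q' (z % (2 * k + 1))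
        (z / (2 * k + 1) / n) (z / (2 * k + 1) % n) → s.arr 4 (z / (2 * k + 1)) ≠ 0 :=
      fun z hz hzj => hF z (by omega)
    generalize hxe : j / (2 * k + 1) = x at *
    generalize hle : j % (2 * k + 1) = l at *
    generalize hpe : x / n = p at *
    generalize hqe : x % n = q at *
    have hl' := invCode_lt hl
    refine WP.assign_seq (v := l) (by decide) ?_ ?_ ?_
    · apply Expr.fits_mod <;> simp [Expr.Fits, Expr.eval, hs.var_K, hi] <;> omega
    · simp [Expr.eval, hs.var_K, hi, hle]
    refine WP.assign_seq (v := x) (by decide) ?_ ?_ ?_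
    · simp [Expr.Fits, hs.var_K, hi]; omega
    · simp [Expr.eval, hs.var_K, hi, hxe]
    refine WP.assign_seq (v := p) (by decide) ?_ ?_ ?_
    · simp [Expr.Fits, hs.var_n]; omega
    · simp [Expr.eval, hs.var_n, hpe]
    refine WP.assign_seq (v := q) (by decide) ?_ ?_ ?_
    · apply Expr.fits_mod <;> simp [Expr.Fits, Expr.eval, hs.var_n] <;> omega
    · simp [Expr.eval, hs.var_n, hqe]
    refine WP.assign_seq (v := invCode l) (by decide) ?_ ?_ ?_
    · apply Expr.fits_inv; simp; omega
    · simp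
    generalize hs₁ : ((((s.setVar 14 l).setVar 15 x).setVar 16 p).setVar 17 q).setVar 18 (invCode l)
      = s₁
    have hc : Ctx n (2 * k + 1) q₀ D F s₁ := by
      rw [← hs₁]
      exact ((((hs.setVar (by omega) _).setVar (by omega) _).setVar (by omega) _).setVar
        (by omega) _).setVar (by omega) _
    have g9 : s₁.var 9 = r := by simp [← hs₁, h9]
    have g10 : s₁.var 10 = j := by simp [← hs₁, hi]
    have g12 : s₁.var 12 = p' := by simp [← hs₁, h12]
    have g13 : s₁.var 13 = q' := by simp [← hs₁, h13]
    have g14 : s₁.var 14 = l := by simp [← hs₁]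
    have g15 : s₁.var 15 = x := by simp [← hs₁]
    have g16 : s₁.var 16 = p := by simp [← hs₁]
    have g17 : s₁.var 17 = q := by simp [← hs₁]
    have g18 : s₁.var 18 = invCode l := by simp [← hs₁]
    have g4 : s₁.arr 4 = s.arr 4 := by simp [← hs₁]
    clear hs₁
    generalize s.arr 4 = A' at *
    have hA' : ∀ x < n * n, A' x ≤ 2 := by
      intro x hx
      have := hA x hx
      rcases hE x hx with h | h <;> omega
    have b₁ := hA' _ (mul_add_lt_mul hp hp')
    have b₂ := hA' _ (mul_add_lt_mul hq' hq)
    have b₃ := hD _ (mul_add_lt_mul (mul_add_lt_mul hp hl) hp')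
    have b₄ := hD _ (mul_add_lt_mul (mul_add_lt_mul hq' hl') hq)
    have b₅ := hA' _ hx
    have m₁ := Nat.mul_le_mul b₁ b₂
    have m₂ := Nat.mul_le_mul b₃ b₄
    -- The factor `1 - A' x` prevents an existing mark from being overwritten. The value of the test
    -- is at most `2 * 2 + 1 * 1 = 5`.
    have m₃ := Nat.mul_le_mul (Nat.add_le_add m₁ m₂) (show 1 - A' x ≤ 1 by omega)
    refine WP.ite (by decide) ⟨⟨⟨⟨?_, ?_⟩, ⟨?_, ?_⟩, ?_⟩, ⟨⟨?_, ?_⟩, ⟨?_, ?_⟩, ?_⟩, ?_⟩,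
      ⟨?_, ?_, ?_⟩, ?_⟩ (fun h => ?_) fun h => ?_
    · apply Expr.fits_pair (a := n) (b := n) <;> (try simp [hc.var_n, g16, g12]) <;> omega
    · simp [hc.var_n, g16, g12, g4]; omega
    · apply Expr.fits_pair (a := n) (b := n) <;> (try simp [hc.var_n, g13, g17]) <;> omega
    · simp [hc.var_n, g13, g17, g4]; omega
    · simp [Expr.eval, hc.var_n, g16, g12, g13, g17, g4]; omega
    · apply Expr.fits_trans (n := n) (K := 2 * k + 1) <;>
        (try simp [hc.var_n, hc.var_K, g16, g14, g12]) <;> omega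
    · simp [hc.var_n, hc.var_K, g16, g14, g12, hc.arr_D]; omega
    · apply Expr.fits_trans (n := n) (K := 2 * k + 1) <;>
        (try simp [hc.var_n, hc.var_K, g13, g18, g17]) <;> omega
    · simp [hc.var_n, hc.var_K, g13, g18, g17, hc.arr_D]; omega
    · simp [Expr.eval, hc.var_n, hc.var_K, g16, g14, g12, g13, g18, g17, hc.arr_D]; omega
    · simp [Expr.eval, hc.var_n, hc.var_K, g16, g14, g12, g13, g18, g17, hc.arr_D, g4]; omega
    · simp [Expr.Fits]; omega
    · simp [Expr.Fits, g15]; omega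
    · simp [Expr.eval, g15, g4]; omega
    · simp [Expr.eval, hc.var_n, hc.var_K, g16, g14, g12, g13, g18, g17, g15, hc.arr_D, g4]; omega
    · simp only [Expr.eval, Expr.eval_pair, Expr.eval_trans, hc.var_n, hc.var_K, g16, g14, g12, g13,
        g18, g17, g15, hc.arr_D, g4, mul_ne_zero_iff] at h
      have hAx : A' x = 0 := by omega
      have hpqS : S p q := by
        by_cases h' : A' (p * n + p') * A' (q' * n + q) = 0
        · have h'' := h.1
          rw [h', zero_add, mul_ne_zero_iff] at h''
          exact hS.label l hl p hp p' hp' q' hq' q hq hpq' h''.1 h''.2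
        · rw [← ne_eq, mul_ne_zero_iff] at h'
          exact hS.trans p hp p' hp' q hq (hE.sound hAS hp hp' h'.1)
            (hS.trans p' hp' q' hq' q hq hpq' (hE.sound hAS hq' hq h'.2))
      refine WP.write (u := x) (v := 1) (by decide) ?_ ?_ ?_ rfl
        ⟨?_, ?_, ?_, ?_, ?_, ?_, ?_⟩
      · simp [Expr.Fits, g15]; omega
      · simp [Expr.Fits]; omega
      · simp [Expr.eval, g15]
      · simp [g10]
      · exact (hc.setArr (by omega) _ _).setVar (by omega) _
      · simpa
      · simpa
      · simpa
      · intro y hy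
        by_cases hyx : y = x
        · right
          subst hyx
          rw [hpe, hqe]
          refine ⟨?_, by simp, hpqS⟩
          rcases hE y hy with h' | h' <;> omega
        · simpa [hyx, g4] using hE y hy
      · intro z hz hf
        by_cases hzx : z / (2 * k + 1) = x
        · simp [hzx]
        · have hzj : z ≠ j := by rintro rfl; exact hzx hxe
          simpa [hzx, g4] using hF' z hz hzj hf
    · simp only [Expr.eval, Expr.eval_pair, Expr.eval_trans, hc.var_n, hc.var_K, g16, g14, g12, g13,
        g18, g17, g15, hc.arr_D, g4, mul_eq_zero, Nat.add_eq_zero_iff] at h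
      refine WP.skip (by decide) ⟨g10, hc.setVar (by omega) _, by simpa, by simpa, by simpa,
        by simpa [g4], ?_⟩
      intro z hz hf
      simp only [Store.setVar_arr, g4]
      by_cases hzj : z = j
      · subst hzj
        rw [hxe, hle, hpe, hqe] at hf
        rw [hxe]
        rcases h with h | h
        · rcases hf with ⟨h₁, h₂⟩ | ⟨h₁, h₂⟩
          · have := hE.ne_zero (mul_add_lt_mul hp hp') h₁
            have := hE.ne_zero (mul_add_lt_mul hq' hq) h₂
            tauto
          · tauto
        · omega
      · exact hF' z hz hzj hf
  · rintro s ⟨hs, h9, -, -, hE, hF⟩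
    refine ⟨hs, h9, hE, fun l hl p hp q hq hf => ?_⟩
    have hpq := mul_add_lt_mul hp hq
    have := hF ((p * n + q) * (2 * k + 1) + l) (mul_add_lt_mul hpq hl)
    rw [mul_add_div_eq hl, mul_add_mod_eq hl, mul_add_div_eq hq, mul_add_mod_eq hq] at this
    exact this hf

/-- One round of the saturation. -/
def roundBody : Prog :=
  .seq (.assign 11 (.var 6)) <|
  .seq (.loop 10 6 pickBody) <|
  .ite (.sub (.var 6) (.var 11))
    (.seq (.write 4 (.var 11) (.lit 2)) <|
      .seq (.assign 12 (.div (.var 11) (.var 0))) <|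
      .seq (.assign 13 (.mod (.var 11) (.var 0))) <|
      .loop 10 7 processBody) .skip

theorem wp_saturate (hb : Bounds B n k) {S : ℕ → ℕ → Prop}
    (hS : TableClosed n (2 * k + 1) D S) (hD : ∀ i < n * (2 * k + 1) * n, D i ≤ 1)
    (hs : Ctx n (2 * k + 1) q₀ D F s) (hA : SatInv n (2 * k + 1) D S 0 (s.arr 4)) :
    WP B (.loop 9 6 roundBody)
      (n * n * (n * n * (20 + 8) + n * n * (2 * k + 1) * (120 + 8) + 50 + 8) + 6)
      (fun s => Ctx n (2 * k + 1) q₀ D F s ∧ SatInv n (2 * k + 1) D S (n * n) (s.arr 4)) s := by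
  have hn := hb.n_le
  have hsq := hb.sq_le
  have h10 := hb.ten_le
  refine WP.loop (by omega) (fun j s hs => hs.1.var_N)
    (Inv := fun j s => Ctx n (2 * k + 1) q₀ D F s ∧ SatInv n (2 * k + 1) D S j (s.arr 4))
    ⟨hs.setVar le_rfl 0, by simpa⟩ ?_
  rintro j hj s ⟨hs, hA⟩ hi
  generalize hA' : s.arr 4 = A at hA
  -- The budget is split along the program: `2` for resetting variable `11`, the scan, and the
  -- processing loop with `30` for the test, the mark and the unpacking of the pair. The constants
  -- add up to `44`.
  refine WP.mono (T := 2 + (n * n * (20 + 8) + 6 + (n * n * (2 * k + 1) * (120 + 8) + 6 + 30)))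
    ?_ (by omega) fun _ => id
  refine WP.assign_seq (v := n * n) (Nat.le_add_right _ _) ?_ ?_ ?_
  · simp [Expr.Fits, hs.var_N]; omega
  · simp [Expr.eval, hs.var_N]
  have h2 : ∀ T, 2 + T - ((Expr.var 6).cost + 1) = T := fun T => Nat.add_sub_cancel_left ..
  rw [h2]
  refine (wp_pick hb (r := j) hA.le_two (hs.setVar (by omega) _) (by simpa) (by simpa)
    (by simp)).seq ?_
  rintro s ⟨hs, h4, h9, h⟩
  refine WP.ite ?_ ?_ (fun h' => ?_) fun h' => ?_
  · simp [Expr.cost]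
  · simp [Expr.Fits, hs.var_N]; omega
  · simp [Expr.eval, hs.var_N] at h'
    obtain ⟨h₁, h₂⟩ : s.var 11 < n * n ∧ A (s.var 11) = 1 := by
      rcases h with h | h
      · omega
      · exact h
    generalize hy : s.var 11 = y at *
    have hp : y / n < n := Nat.div_lt_of_lt_mul h₁
    have hq : y % n < n := Nat.mod_lt _ hb.pos
    refine WP.write_seq (u := y) (v := 2) ?_ ?_ ?_ ?_ rfl ?_
    · simp [Expr.cost]
    · simp [Expr.Fits, hy]; omega
    · simp [Expr.Fits]; omega
    · simp [Expr.eval, hy]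
    refine WP.assign_seq (v := y / n) ?_ ?_ ?_ ?_
    · simp [Expr.cost]
    · simp [Expr.Fits, hs.var_n, hy]; omega
    · simp [Expr.eval, hs.var_n, hy]
    refine WP.assign_seq (v := y % n) ?_ ?_ ?_ ?_
    · simp [Expr.cost, Expr.mod]
    · apply Expr.fits_mod <;> simp [Expr.Fits, Expr.eval, hs.var_n, hy] <;> omega
    · simp [Expr.eval, hs.var_n, hy]
    have hy' : y / n * n + y % n = y := Nat.div_add_mod' _ _
    refine (wp_process hb (A := Function.update A y 2) (r := j) hS hD ?_ ?_ hp hq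
      (hA.sound y h₁ (by omega))
      (((hs.setArr (by omega) _ _).setVar (by omega) _).setVar (by omega) _)
      ?_ ?_ ?_ ?_).mono ?_ ?_
    · intro x hx
      by_cases hxy : x = y
      · simp [hxy]
      · simpa [hxy] using hA.le_two x hx
    · intro x hx h₃
      by_cases hxy : x = y
      · rw [hxy]; exact hA.sound y h₁ (by omega)
      · exact hA.sound x hx (by simpa [hxy] using h₃)
    · simp [h4]
    · simp [h9]
    · simp
    · simp
    · simp [Expr.cost, Expr.mod]
    · rintro s ⟨hs, h9, hE, hF⟩
      refine ⟨h9, hs.setVar le_rfl _, ?_⟩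
      exact hA.next hp hq (by omega) (by rwa [hy']) (by rwa [hy']) (by rwa [hy'])
  · simp [Expr.eval, hs.var_N] at h'
    refine WP.skip ?_ ⟨h9, hs.setVar le_rfl _, ?_⟩
    · simp [Expr.cost]
    · rcases h with h | h
      · rw [Store.setVar_arr, h4]
        exact hA.skip h.2 _
      · omega

end RAM

/-! ### Output tables and the total running time -/

namespace RAM

variable {B n k K q₀ : ℕ} {D F A : ℕ → ℕ} {s : Store}

/-- The entry for states `p`, `q` and label `l` of the transition table of the automaton for the
reduced words, where `D` is the transition table of the given automaton and `A` holds the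
`ε`-transitions of the saturated one. -/
def reducedEntry (n K : ℕ) (D A : ℕ → ℕ) (p l q : ℕ) : ℕ :=
  if l = 0 then if p / n = q / n ∧ A (p % n * n + q % n) ≠ 0 then 1 else 0
  else if q / n = l ∧ p / n ≠ invCode l ∧ D ((p % n * K + l) * n + q % n) ≠ 0 then 1 else 0

/-- Write the entry with the index in variable `10` of the transition table to array `2`. -/
def tableBody : Prog :=
  .seq (.assign 15 (.div (.var 10) (.var 3))) <|
  .seq (.assign 14 (.mod (.var 15) (.var 5))) <|
  .seq (.assign 18 (.inv 14)) <|
  .seq (.assign 16 (.div (.var 15) (.var 5))) <|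
  .seq (.assign 19 (.div (.var 16) (.var 0))) <|
  .seq (.assign 16 (.mod (.var 16) (.var 0))) <|
  .seq (.assign 17 (.mod (.var 10) (.var 3))) <|
  .seq (.assign 20 (.div (.var 17) (.var 0))) <|
  .seq (.assign 17 (.mod (.var 17) (.var 0))) <|
  .ite (.var 14)
    (.write 2 (.var 10) (.mul (.mul (.eq 20 14) (.sub (.lit 1) (.eq 19 18)))
      (.get 0 (.trans 16 14 17))))
    (.write 2 (.var 10) (.mul (.eq 19 20)
      (.sub (.lit 1) (.sub (.lit 1) (.get 4 (.pair 16 17))))))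

theorem wp_table (hb : Bounds B n k) (hD : ∀ i < n * (2 * k + 1) * n, D i ≤ 1)
    (hA : ∀ x < n * n, A x ≤ 2) (hs : Ctx n (2 * k + 1) q₀ D F s) (h4 : s.arr 4 = A) :
    WP B (.loop 10 8 tableBody) ((2 * k + 1) * n * (2 * k + 1) * ((2 * k + 1) * n) * (130 + 8) + 6)
      (fun s => Ctx n (2 * k + 1) q₀ D F s ∧
        ∀ p < (2 * k + 1) * n, ∀ l < 2 * k + 1, ∀ q < (2 * k + 1) * n,
          s.arr 2 ((p * (2 * k + 1) + l) * ((2 * k + 1) * n) + q) =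
            reducedEntry n (2 * k + 1) D A p l q) s := by
  have hn := hb.n_le
  have hk := hb.k_le
  have h2 := hb.mul_mul_le
  have hsq := hb.sq_le
  have h10 := hb.ten_le
  have hL := hb.table_le
  have hm := hb.mul_le
  rw [mul_comm] at hm
  have hm0 : 0 < (2 * k + 1) * n := Nat.mul_pos (by omega) hb.pos
  generalize hme : (2 * k + 1) * n = m at *
  refine WP.mono (WP.loop (T := 130) (b := m * (2 * k + 1) * m) (by omega)
    (fun j s hs => hs.1.var_L.trans (by rw [hme]))
    (Inv := fun j s => Ctx n (2 * k + 1) q₀ D F s ∧ s.arr 4 = A ∧ ∀ z < j, s.arr 2 z =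
      reducedEntry n (2 * k + 1) D A (z / m / (2 * k + 1)) (z / m % (2 * k + 1)) (z % m))
    ⟨hs.setVar (by omega) 0, by simpa, by simp⟩ ?_) le_rfl ?_
  · rintro j hj s ⟨hs, h4, hO⟩ hi
    have h3 : s.var 3 = m := hs.var_m.trans hme
    have hx : j / m < m * (2 * k + 1) := Nat.div_lt_of_lt_mul (by rwa [mul_comm])
    have hl : j / m % (2 * k + 1) < 2 * k + 1 := Nat.mod_lt _ (by omega)
    have hp : j / m / (2 * k + 1) < m := Nat.div_lt_of_lt_mul (by rwa [mul_comm])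
    have hq : j % m < m := Nat.mod_lt _ hm0
    have hmB := Nat.le_mul_of_pos_right m (show 0 < 2 * k + 1 by omega)
    have hmB' := Nat.le_mul_of_pos_right (m * (2 * k + 1)) hm0
    have hO' : ∀ z < j + 1, z ≠ j → s.arr 2 z = reducedEntry n (2 * k + 1) D A
        (z / m / (2 * k + 1)) (z / m % (2 * k + 1)) (z % m) := fun z hz hzj => hO z (by omega)
    generalize hxe : j / m = x at *
    generalize hle : x % (2 * k + 1) = l at *
    generalize hpe : x / (2 * k + 1) = p at *
    generalize hqe : j % m = q at *
    have hl' := invCode_lt hl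
    have hc : p / n < 2 * k + 1 := Nat.div_lt_of_lt_mul (by rwa [mul_comm, hme])
    have hd : q / n < 2 * k + 1 := Nat.div_lt_of_lt_mul (by rwa [mul_comm, hme])
    have hpn : p % n < n := Nat.mod_lt _ hb.pos
    have hqn : q % n < n := Nat.mod_lt _ hb.pos
    refine WP.assign_seq (v := x) (by decide) ?_ ?_ ?_
    · simp [Expr.Fits, h3, hi]; omega
    · simp [Expr.eval, h3, hi, hxe]
    refine WP.assign_seq (v := l) (by decide) ?_ ?_ ?_
    · apply Expr.fits_mod <;> simp [Expr.Fits, Expr.eval, hs.var_K] <;> omega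
    · simp [Expr.eval, hs.var_K, hle]
    refine WP.assign_seq (v := invCode l) (by decide) ?_ ?_ ?_
    · apply Expr.fits_inv; simp; omega
    · simp
    refine WP.assign_seq (v := p) (by decide) ?_ ?_ ?_
    · simp [Expr.Fits, hs.var_K]; omega
    · simp [Expr.eval, hs.var_K, hpe]
    refine WP.assign_seq (v := p / n) (by decide) ?_ ?_ ?_
    · simp [Expr.Fits, hs.var_n]; omega
    · simp [Expr.eval, hs.var_n]
    refine WP.assign_seq (v := p % n) (by decide) ?_ ?_ ?_
    · apply Expr.fits_mod <;> simp [Expr.Fits, Expr.eval, hs.var_n] <;> omega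
    · simp [Expr.eval, hs.var_n]
    refine WP.assign_seq (v := q) (by decide) ?_ ?_ ?_
    · apply Expr.fits_mod <;> simp [Expr.Fits, Expr.eval, h3, hi] <;> omega
    · simp [Expr.eval, h3, hi, hqe]
    refine WP.assign_seq (v := q / n) (by decide) ?_ ?_ ?_
    · simp [Expr.Fits, hs.var_n]; omega
    · simp [Expr.eval, hs.var_n]
    refine WP.assign_seq (v := q % n) (by decide) ?_ ?_ ?_
    · apply Expr.fits_mod <;> simp [Expr.Fits, Expr.eval, hs.var_n] <;> omega
    · simp [Expr.eval, hs.var_n]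
    generalize hs₁ : ((((((((s.setVar 15 x).setVar 14 l).setVar 18 (invCode l)).setVar 16 p).setVar
      19 (p / n)).setVar 16 (p % n)).setVar 17 q).setVar 20 (q / n)).setVar 17 (q % n) = s₁
    have hc₁ : Ctx n (2 * k + 1) q₀ D F s₁ := by
      rw [← hs₁]
      exact ((((((((hs.setVar (by omega) _).setVar (by omega) _).setVar (by omega) _).setVar
        (by omega) _).setVar (by omega) _).setVar (by omega) _).setVar (by omega) _).setVar
        (by omega) _).setVar (by omega) _
    have g10 : s₁.var 10 = j := by simp [← hs₁, hi]
    have g14 : s₁.var 14 = l := by simp [← hs₁]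
    have g16 : s₁.var 16 = p % n := by simp [← hs₁]
    have g17 : s₁.var 17 = q % n := by simp [← hs₁]
    have g18 : s₁.var 18 = invCode l := by simp [← hs₁]
    have g19 : s₁.var 19 = p / n := by simp [← hs₁]
    have g20 : s₁.var 20 = q / n := by simp [← hs₁]
    have g4 : s₁.arr 4 = A := by simp [← hs₁, h4]
    have g2 : s₁.arr 2 = s.arr 2 := by simp [← hs₁]
    clear hs₁
    have bD := hD _ (mul_add_lt_mul (mul_add_lt_mul hpn hl) hqn)
    have bA := hA _ (mul_add_lt_mul hpn hqn)
    have hfin : ∀ {e : Expr} {T : ℕ}, e.cost + 2 ≤ T → e.Fits B s₁ →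
        e.eval s₁ = reducedEntry n (2 * k + 1) D A p l q →
        WP B (.write 2 (.var 10) e) T (fun s' => s'.var 10 = j ∧
          Ctx n (2 * k + 1) q₀ D F (s'.setVar 10 (j + 1)) ∧ (s'.setVar 10 (j + 1)).arr 4 = A ∧
          ∀ z < j + 1, (s'.setVar 10 (j + 1)).arr 2 z = reducedEntry n (2 * k + 1) D A
            (z / m / (2 * k + 1)) (z / m % (2 * k + 1)) (z % m)) s₁ := by
      intro e T hT he hv
      refine WP.write (u := j) (by simp only [Expr.cost]; omega) ?_ he ?_ hv ⟨?_, ?_, ?_, ?_⟩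
      · simp [Expr.Fits, g10]; omega
      · simp [Expr.eval, g10]
      · simp [g10]
      · exact (hc₁.setArr le_rfl _ _).setVar (by omega) _
      · simpa
      · intro z hz
        by_cases hzj : z = j
        · simp [hzj, hxe, hpe, hle, hqe]
        · simpa [hzj, g2] using hO' z hz hzj
    have e₁ : ∀ (x y : ℕ), (if x = y then 1 else 0) ≤ 1 := by intro x y; split_ifs <;> omega
    have f₁ := e₁ (q / n) l
    have f₂ := e₁ (p / n) (q / n)
    have f₃ := e₁ (p / n) (invCode l)
    refine WP.ite (by decide) ?_ (fun h => ?_) fun h => ?_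
    · simp [Expr.Fits, g14]; omega
    · have hl0 : l ≠ 0 := by simpa [Expr.eval, g14] using h
      refine hfin (by decide) ⟨⟨?_, ⟨?_, ?_⟩, ?_⟩, ⟨?_, ?_⟩, ?_⟩ ?_
      · apply Expr.fits_eq <;> (try simp [g20, g14]) <;> omega
      · simp [Expr.Fits]; omega
      · apply Expr.fits_eq <;> (try simp [g18, g19]) <;> omega
      · have := Nat.mul_le_mul f₁ (show 1 - (if p / n = invCode l then 1 else 0) ≤ 1 by omega)
        simp only [Expr.eval, Expr.eval_eq, g20, g14, g18, g19]; omega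
      · apply Expr.fits_trans (n := n) (K := 2 * k + 1) <;>
          (try simp [hc₁.var_n, hc₁.var_K, g16, g14, g17]) <;> omega
      · simp [hc₁.var_n, hc₁.var_K, g16, g14, g17, hc₁.arr_D]; omega
      · have := Nat.mul_le_mul (Nat.mul_le_mul f₁
          (show 1 - (if p / n = invCode l then 1 else 0) ≤ 1 by omega)) bD
        simp only [Expr.eval, Expr.eval_eq, Expr.eval_trans, g20, g14, g18, g19, g16, g17,
          hc₁.var_n, hc₁.var_K, hc₁.arr_D]; omega
      · simp only [Expr.eval, Expr.eval_eq, Expr.eval_trans, g20, g14, g18, g19, g16, g17,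
          hc₁.var_n, hc₁.var_K, hc₁.arr_D, reducedEntry, if_neg hl0]
        by_cases c₁ : q / n = l <;> by_cases c₂ : p / n = invCode l <;> simp [c₁, c₂]
        split_ifs <;> omega
    -- With truncated subtraction, `1 - (1 - a)` turns both marks `1` and `2` into the table entry
    -- `1`.
    · have hl0 : l = 0 := by simpa [Expr.eval, g14] using h
      refine hfin (by decide) ⟨?_, ⟨?_, ?_, ?_, ?_⟩, ?_⟩ ?_
      · apply Expr.fits_eq <;> (try simp [g20, g19]) <;> omega
      · simp [Expr.Fits]; omega
      · simp [Expr.Fits]; omega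
      · apply Expr.fits_pair (a := n) (b := n) <;> (try simp [hc₁.var_n, g16, g17]) <;> omega
      · simp [hc₁.var_n, g16, g17, g4]; omega
      · have := Nat.mul_le_mul f₂ (show 1 - (1 - A (p % n * n + q % n)) ≤ 1 by omega)
        simp only [Expr.eval, Expr.eval_eq, Expr.eval_pair, g20, g19, g16, g17, hc₁.var_n, g4]
        omega
      · simp only [Expr.eval, Expr.eval_eq, Expr.eval_pair, g20, g19, g16, g17, hc₁.var_n, g4,
          reducedEntry, if_pos hl0]
        by_cases c₁ : p / n = q / n <;> simp [c₁]
        split_ifs <;> omega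
  · rintro s ⟨hs, -, hO⟩
    refine ⟨hs, fun p hp l hl q hq => ?_⟩
    have hpl := mul_add_lt_mul hp hl
    have := hO ((p * (2 * k + 1) + l) * m + q) (mul_add_lt_mul hpl hq)
    rwa [mul_add_div_eq hq, mul_add_mod_eq hq, mul_add_div_eq hl, mul_add_mod_eq hl] at this

/-- Write the entry with the index in variable `10` of the table of accepting states to
array `3`. -/
def acceptBody : Prog := .write 3 (.var 10) (.get 1 (.mod (.var 10) (.var 0)))

theorem wp_accept (hb : Bounds B n k) (hF : ∀ i < n, F i ≤ 1)
    (hs : Ctx n (2 * k + 1) q₀ D F s) {O : ℕ → ℕ} (h2 : s.arr 2 = O) :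
    WP B (.loop 10 3 acceptBody) ((2 * k + 1) * n * (20 + 8) + 6)
      (fun s => Ctx n (2 * k + 1) q₀ D F s ∧ s.arr 2 = O ∧
        ∀ p < (2 * k + 1) * n, s.arr 3 p = F (p % n)) s := by
  have hn := hb.n_le
  have h10 := hb.ten_le
  have hm := hb.mul_le
  rw [mul_comm n] at hm
  refine WP.loop (by omega) (fun j s hs => hs.1.var_m)
    (Inv := fun j s => Ctx n (2 * k + 1) q₀ D F s ∧ s.arr 2 = O ∧ ∀ p < j, s.arr 3 p = F (p % n))
    ⟨hs.setVar (by omega) 0, by simpa, by simp⟩ ?_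
  rintro j hj s ⟨hs, h2, h⟩ hi
  have hFj := hF _ (Nat.mod_lt j hb.pos)
  refine WP.write (u := j) (v := F (j % n)) (by decide) ?_ ⟨?_, ?_⟩ ?_ ?_ ⟨?_, ?_, ?_, ?_⟩
  · simp [Expr.Fits, hi]; omega
  · apply Expr.fits_mod <;> simp [Expr.Fits, Expr.eval, hs.var_n, hi] <;> omega
  · simp [Expr.eval, hs.var_n, hi, hs.arr_F]; omega
  · simp [Expr.eval, hi]
  · simp [Expr.eval, hs.var_n, hi, hs.arr_F]
  · simp [hi]
  · exact (hs.setArr (by omega) _ _).setVar (by omega) _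
  · simpa
  · intro p hp
    by_cases hpj : p = j
    · simp [hpj]
    · simpa [hpj] using h p (by omega)

/-- Compute the sizes that are needed later. -/
def setup (P : Prog) : Prog :=
  .seq (.assign 5 (.add (.mul (.lit 2) (.var 1)) (.lit 1))) <|
  .seq (.assign 6 (.mul (.var 0) (.var 0))) <|
  .seq (.assign 7 (.mul (.var 6) (.var 5))) <|
  .seq (.assign 3 (.mul (.var 5) (.var 0))) <|
  .seq (.assign 8 (.mul (.mul (.var 3) (.var 5)) (.var 3))) <|
  .seq (.assign 4 (.var 2)) P

theorem wp_setup (hb : Bounds B n k) (h0 : s.var 0 = n) (h1 : s.var 1 = k) (h2 : s.var 2 = q₀)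
    (hq₀ : q₀ < n) {P : Prog} {T : ℕ} {Q : Store → Prop}
    (h : ∀ s', Ctx n (2 * k + 1) q₀ (s.arr 0) (s.arr 1) s' → WP B P T Q s') :
    WP B (setup P) (50 + T) Q s := by
  have hn := hb.n_le
  have hk := hb.k_le
  have hnk := hb.mul_mul_le
  have hNK : n * n * (2 * k + 1) = n * (2 * k + 1) * n := by ring
  have hm := hb.mul_le
  rw [mul_comm n] at hm
  have hsq := hb.sq_le
  have h10 := hb.ten_le
  have hL := hb.table_le
  have hL' := Nat.le_mul_of_pos_right ((2 * k + 1) * n * (2 * k + 1))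
    (Nat.mul_pos (show 0 < 2 * k + 1 by omega) hb.pos)
  refine WP.assign_seq (v := 2 * k + 1) (by simp [Expr.cost]; omega) ?_ ?_ ?_
  · simp [Expr.Fits, Expr.eval, h1]; omega
  · simp [Expr.eval, h1]
  refine WP.assign_seq (v := n * n) (by simp [Expr.cost]; omega) ?_ ?_ ?_
  · simp [Expr.Fits, Expr.eval, h0]; omega
  · simp [Expr.eval, h0]
  refine WP.assign_seq (v := n * n * (2 * k + 1)) (by simp [Expr.cost]; omega) ?_ ?_ ?_
  · simp [Expr.Fits, Expr.eval]; omega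
  · simp [Expr.eval]
  refine WP.assign_seq (v := (2 * k + 1) * n) (by simp [Expr.cost]; omega) ?_ ?_ ?_
  · simp [Expr.Fits, Expr.eval, h0]; omega
  · simp [Expr.eval, h0]
  refine WP.assign_seq (v := (2 * k + 1) * n * (2 * k + 1) * ((2 * k + 1) * n))
    (by simp [Expr.cost]; omega) ?_ ?_ ?_
  · simp [Expr.Fits, Expr.eval]; omega
  · simp [Expr.eval]
  refine WP.assign_seq (v := q₀) (by simp [Expr.cost]; omega) ?_ ?_ ?_
  · simp [Expr.Fits, h2]; omega
  · simp [Expr.eval, h2]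
  refine (h _ ?_).mono (by simp [Expr.cost]; omega) fun _ => id
  constructor <;> simp [h0]

/-- The program that computes an automaton for the language of the reduced words. -/
def reduceProg : Prog :=
  setup <|
  .seq (.loop 9 6 initBody) <|
  .seq (.loop 9 6 roundBody) <|
  .seq (.loop 10 8 tableBody) (.loop 10 3 acceptBody)

/-- No entry is `2` yet, so the rules for processed pairs hold vacuously. -/
theorem _root_.SatInv.init {S : ℕ → ℕ → Prop} (hn : 0 < n) (hS : TableClosed n K D S)
    (h : ∀ x < n * n, A x =
      if x / n = x % n ∨ D (x / n * K * n + x % n) ≠ 0 then 1 else 0) :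
    SatInv n K D S 0 A where
  le_two x hx := by rw [h x hx]; split_ifs <;> omega
  sound x hx hA := by
    have hp : x / n < n := Nat.div_lt_of_lt_mul hx
    have hq : x % n < n := Nat.mod_lt _ hn
    rw [h x hx] at hA
    split_ifs at hA with h'
    · rcases h' with h' | h'
      · rw [← h']; exact hS.refl _ hp
      · exact hS.eps _ hp _ hq h'
    · exact absurd rfl hA
  refl p hp := by
    rw [h _ (mul_add_lt_mul hp hp), mul_add_div_eq hp, mul_add_mod_eq hp]
    simp
  eps p hp q hq hD := by
    rw [h _ (mul_add_lt_mul hp hq), mul_add_div_eq hq, mul_add_mod_eq hq]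
    simp [hD]
  trans p hp q hq r hr hA := by
    rw [h _ (mul_add_lt_mul hp hq)] at hA
    split_ifs at hA; omega
  label l hl p hp p' hp' q' hq' q hq hA := by
    rw [h _ (mul_add_lt_mul hp' hq')] at hA
    split_ifs at hA; omega
  count _ := Nat.zero_le _

theorem wp_reduceProg (hb : Bounds B n k) (h0 : s.var 0 = n) (h1 : s.var 1 = k)
    (h2 : s.var 2 = q₀) (hq₀ : q₀ < n) (hD : ∀ i < n * (2 * k + 1) * n, s.arr 0 i ≤ 1)
    (hF : ∀ i < n, s.arr 1 i ≤ 1) {S : ℕ → ℕ → Prop}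
    (hS : TableClosed n (2 * k + 1) (s.arr 0) S) :
    WP B reduceProg (1000 * (2 * k + 1) ^ 3 * n ^ 4) (fun s' => ∃ A : ℕ → ℕ,
      TableClosed n (2 * k + 1) (s.arr 0) (fun p q => A (p * n + q) ≠ 0) ∧
      (∀ p < n, ∀ q < n, A (p * n + q) ≠ 0 → S p q) ∧
      s'.var 3 = (2 * k + 1) * n ∧ s'.var 4 = q₀ ∧
      (∀ p < (2 * k + 1) * n, ∀ l < 2 * k + 1, ∀ q < (2 * k + 1) * n,
        s'.arr 2 ((p * (2 * k + 1) + l) * ((2 * k + 1) * n) + q) =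
          reducedEntry n (2 * k + 1) (s.arr 0) A p l q) ∧
      ∀ p < (2 * k + 1) * n, s'.arr 3 p = s.arr 1 (p % n)) s := by
  refine (wp_setup hb h0 h1 h2 hq₀ fun s₁ hs₁ => (wp_init hb hD hs₁).seq fun s₂ hs₂ =>
    (wp_saturate hb hS hD hs₂.1 (.init hb.pos hS hs₂.2)).seq fun s₃ hs₃ =>
    (wp_table hb hD hs₃.2.le_two hs₃.1 rfl).seq fun s₄ hs₄ =>
    (wp_accept hb hF hs₄.1 rfl).mono le_rfl fun s₅ hs₅ => ?_).mono ?_ fun _ => id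
  · refine ⟨s₃.arr 4, hs₃.2.tableClosed, fun p hp q hq hA => ?_, hs₅.1.var_m, hs₅.1.var_q,
      hs₅.2.1 ▸ hs₄.2, hs₅.2.2⟩
    have := hs₃.2.sound _ (mul_add_lt_mul hp hq) hA
    rwa [mul_add_div_eq hq, mul_add_mod_eq hq] at this
  · have hn : 1 ≤ n := hb.pos
    have e₁ : 1 ≤ (2 * k + 1) ^ 3 * n ^ 4 := Nat.mul_pos (by positivity) (by positivity)
    have e₂ : n * n ≤ (2 * k + 1) ^ 3 * n ^ 4 :=
      calc n * n = 1 * n ^ 2 := by ring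
        _ ≤ _ := Nat.mul_le_mul (Nat.one_le_pow _ _ (by omega))
          (Nat.pow_le_pow_right hn (by omega))
    have e₃ : n * n * (n * n) ≤ (2 * k + 1) ^ 3 * n ^ 4 :=
      calc n * n * (n * n) = 1 * n ^ 4 := by ring
        _ ≤ _ := Nat.mul_le_mul_right _ (Nat.one_le_pow _ _ (by omega))
    have e₄ : n * n * (n * n * (2 * k + 1)) ≤ (2 * k + 1) ^ 3 * n ^ 4 :=
      calc n * n * (n * n * (2 * k + 1)) = (2 * k + 1) ^ 1 * n ^ 4 := by ring
        _ ≤ _ := Nat.mul_le_mul_right _ (Nat.pow_le_pow_right (by omega) (by omega))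
    have e₅ : (2 * k + 1) * n * (2 * k + 1) * ((2 * k + 1) * n) ≤ (2 * k + 1) ^ 3 * n ^ 4 :=
      calc (2 * k + 1) * n * (2 * k + 1) * ((2 * k + 1) * n) = (2 * k + 1) ^ 3 * n ^ 2 := by ring
        _ ≤ _ := Nat.mul_le_mul_left _ (Nat.pow_le_pow_right hn (by omega))
    have e₆ : (2 * k + 1) * n ≤ (2 * k + 1) ^ 3 * n ^ 4 :=
      calc (2 * k + 1) * n = (2 * k + 1) ^ 1 * n ^ 1 := by ring
        _ ≤ _ := Nat.mul_le_mul (Nat.pow_le_pow_right (by omega) (by omega))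
          (Nat.pow_le_pow_right hn (by omega))
    have e₇ : n * n * (n * n * (20 + 8) + n * n * (2 * k + 1) * (120 + 8) + 50 + 8) =
        28 * (n * n * (n * n)) + 128 * (n * n * (n * n * (2 * k + 1))) + 58 * (n * n) := by ring
    rw [e₇, mul_assoc 1000]
    omega

end RAM

/-! ### Translation between tables and automata, and the main theorem -/

section Tables

variable {k n : ℕ} {M : εNFA (Letter k) (Fin n)} {q₀ : Fin n} {s : RAM.Store}

open Classical in
theorem RAM.Store.Holds.table_eq (h : s.Holds 0 2 0 1 M q₀) (p : Fin n) (l : Option (Letter k))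
    (q : Fin n) : s.arr 0 ((p * (2 * k + 1) + labelCode l) * n + q) =
      if q ∈ M.step p l then 1 else 0 := h.2.2.2.1 p l q

theorem RAM.Store.Holds.table_ne_zero_iff (h : s.Holds 0 2 0 1 M q₀) (p : Fin n)
    (l : Option (Letter k)) (q : Fin n) :
    s.arr 0 ((p * (2 * k + 1) + labelCode l) * n + q) ≠ 0 ↔ q ∈ M.step p l := by
  rw [h.table_eq]
  simp

/-- As `labelCode` takes all values below `2k + 1`, every index in the range belongs to a
transition, and its entry is determined by `Holds`. -/
theorem RAM.Store.Holds.table_le_one (h : s.Holds 0 2 0 1 M q₀) {i : ℕ}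
    (hi : i < n * (2 * k + 1) * n) : s.arr 0 i ≤ 1 := by
  have hn : 0 < n := q₀.pos
  have hx : i / n < n * (2 * k + 1) := Nat.div_lt_of_lt_mul (by rwa [mul_comm])
  have hp : i / n / (2 * k + 1) < n := Nat.div_lt_of_lt_mul (by rwa [mul_comm])
  have hl : i / n % (2 * k + 1) < 2 * k + 1 := Nat.mod_lt _ (by omega)
  have := h.table_eq ⟨_, hp⟩ ((labelEquiv k).symm ⟨_, hl⟩) ⟨_, Nat.mod_lt i hn⟩
  rw [← labelEquiv_val, Equiv.apply_symm_apply] at this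
  simp only [Nat.div_add_mod'] at this
  rw [this]
  split_ifs <;> omega

theorem RAM.Store.Holds.accept_le_one (h : s.Holds 0 2 0 1 M q₀) {i : ℕ} (hi : i < n) :
    s.arr 1 i ≤ 1 := by
  have := h.2.2.2.2 ⟨i, hi⟩
  simp only at this
  rw [this]
  split_ifs <;> omega

theorem exists_labelCode_eq {k l : ℕ} (hl : l < 2 * k + 1) :
    ∃ a : Option (Letter k), labelCode a = l :=
  ⟨(labelEquiv k).symm ⟨l, hl⟩, by rw [← labelEquiv_val, Equiv.apply_symm_apply]⟩

theorem labelCode_none {k : ℕ} : labelCode (none : Option (Letter k)) = 0 := rfl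

theorem labelCode_some_ne_zero {k : ℕ} (a : Letter k) : labelCode (some a) ≠ 0 := by
  simp only [labelCode]
  omega

theorem RAM.Store.Holds.tableClosed_iff (h : s.Holds 0 2 0 1 M q₀) (S : ℕ → ℕ → Prop) :
    TableClosed n (2 * k + 1) (s.arr 0) S ↔ M.IsCancelClosed fun p q => S p q := by
  constructor
  · intro hS
    refine ⟨fun p => hS.refl p p.2, fun p q r => hS.trans p p.2 q q.2 r r.2, fun p q hq => ?_,
      fun a p p' q' q hp hpq hq => ?_⟩
    · exact hS.eps p p.2 q q.2 ((h.table_ne_zero_iff p none q).2 hq)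
    · refine hS.label (labelCode (some a)) (labelCode_lt _) p p.2 p' p'.2 q' q'.2 q q.2 hpq
        ((h.table_ne_zero_iff p (some a) p').2 hp) ?_
      rw [← labelCode_inv]
      exact (h.table_ne_zero_iff q' _ q).2 hq
  · intro hS
    refine ⟨fun p hp => hS.refl ⟨p, hp⟩,
      fun p hp q hq r hr => hS.trans ⟨p, hp⟩ ⟨q, hq⟩ ⟨r, hr⟩,
      fun p hp q hq hD => hS.eps ⟨p, hp⟩ ⟨q, hq⟩ ((h.table_ne_zero_iff _ none _).1 hD),
      fun l hl p hp p' hp' q' hq' q hq hpq hD hD' => ?_⟩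
    obtain ⟨_ | a, rfl⟩ := exists_labelCode_eq hl
    -- For label `0` the rule asks for an extension by `ε`-transitions on both sides, which already
    -- follows from `eps` and `trans`.
    · rw [labelCode_none, invCode_zero, ← labelCode_none (k := k)] at hD'
      have h₁ := hS.eps _ _ ((h.table_ne_zero_iff ⟨p, hp⟩ none ⟨p', hp'⟩).1 hD)
      have h₂ := hS.eps _ _ ((h.table_ne_zero_iff ⟨q', hq'⟩ none ⟨q, hq⟩).1 hD')
      exact hS.trans _ ⟨q', hq'⟩ _ (hS.trans _ ⟨p', hp'⟩ ⟨q', hq'⟩ h₁ hpq) h₂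
    · rw [← labelCode_inv] at hD'
      exact hS.letter a ⟨p, hp⟩ ⟨p', hp'⟩ ⟨q', hq'⟩ ⟨q, hq⟩
        ((h.table_ne_zero_iff _ _ _).1 hD) hpq ((h.table_ne_zero_iff _ _ _).1 hD')

open Classical in
theorem RAM.Store.Holds.reducedEntry_eq (h : s.Holds 0 2 0 1 M q₀) (A : ℕ → ℕ)
    (p : Fin ((2 * k + 1) * n)) (l : Option (Letter k)) (q : Fin ((2 * k + 1) * n)) :
    RAM.reducedEntry n (2 * k + 1) (s.arr 0) A p (labelCode l) q =
      if q ∈ (M.reducedNFA (fun p q => A (p * n + q) ≠ 0) (stateEquiv k n) q₀).step p l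
        then 1 else 0 := by
  cases l with
  | none =>
    rw [RAM.reducedEntry, if_pos labelCode_none]
    refine if_congr ?_ rfl rfl
    rw [← labelCode_stateEquiv_symm_snd, ← labelCode_stateEquiv_symm_snd, ← stateEquiv_symm_fst,
      ← stateEquiv_symm_fst, labelCode_injective.eq_iff]
    rfl
  | some a =>
    rw [RAM.reducedEntry, if_neg (labelCode_some_ne_zero a)]
    refine if_congr ?_ rfl rfl
    rw [← labelCode_stateEquiv_symm_snd, ← labelCode_stateEquiv_symm_snd, ← stateEquiv_symm_fst,
      ← stateEquiv_symm_fst, labelCode_injective.eq_iff, ← labelCode_inv,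
      labelCode_injective.ne_iff, h.table_ne_zero_iff]
    rfl

end Tables

/-- There is one program `P` that builds, from an `ε`-NFA `M` with `n` states over an alphabet with
`k` letters and their inverses, an `ε`-NFA `Mr` for `r(L(M))`. For every fixed `k`, its running time
is `O(n ^ 4)`, on a machine with words of `O(log n)` bits (that is, numbers up to `C * n ^ d`). The
input is given in variables `0, 1, 2` and arrays `0, 1`, nothing is assumed about the remaining
memory, and the output is delivered in variables `3, 4` and arrays `2, 3`. -/
theorem proposition1 :
    ∃ (P : RAM.Prog) (d : ℕ), ∀ k : ℕ, ∃ C : ℕ,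
      ∀ (n : ℕ) (M : εNFA (Letter k) (Fin n)) (q₀ : Fin n) (s : RAM.Store),
        s.Holds 0 2 0 1 M q₀ → s.var 1 = k →
        ∃ (t : ℕ) (s' : RAM.Store) (m : ℕ) (Mr : εNFA (Letter k) (Fin m)) (r₀ : Fin m),
          RAM.Runs (C * n ^ d) P s t s' ∧ t ≤ C * n ^ 4 ∧
          s'.Holds 3 4 2 3 Mr r₀ ∧
          Mr.accepts = reducedLanguage M.accepts := by
  -- The same constant serves for time and word size: `Bounds` asks for only `10 * (2k + 1)³ n²`, a
  -- multiple of the length of the output table.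
  refine ⟨RAM.reduceProg, 2, fun k => ⟨1000 * (2 * k + 1) ^ 3, fun n M q₀ s hs hk => ?_⟩⟩
  have hb : RAM.Bounds (1000 * (2 * k + 1) ^ 3 * n ^ 2) n k := by
    refine ⟨q₀.pos, ?_⟩
    rw [mul_assoc]
    exact Nat.mul_le_mul_right _ (by omega)
  -- The upper bound for the saturation is `Cancels`, transported to natural numbers; its last
  -- component yields the soundness of the marked pairs at the end.
  have hS : TableClosed n (2 * k + 1) (s.arr 0)
      fun p q => ∃ (hp : p < n) (hq : q < n), M.Cancels ⟨p, hp⟩ ⟨q, hq⟩ := by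
    rw [hs.tableClosed_iff]
    simpa using M.isCancelClosed_cancels
  obtain ⟨t, s', hrun, ht, A, hA, hAS, h3, h4, hT, hF⟩ := RAM.wp_reduceProg hb hs.2.1 hk
    hs.2.2.1 q₀.2 (fun i => hs.table_le_one) (fun i => hs.accept_le_one) hS
  refine ⟨t, s', (2 * k + 1) * n, M.reducedNFA (fun p q => A (p * n + q) ≠ 0) (stateEquiv k n) q₀,
    stateEquiv k n (q₀, none), hrun, ht, ⟨rfl, h3, ?_, fun p l q => ?_, fun p => ?_⟩, ?_⟩
  -- The code of `none` is `0`, so the new initial state has the same number as `q₀`.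
  · rw [h4, stateEquiv_val]
    simp [labelCode]
  · rw [hT p p.2 _ (labelCode_lt l) q q.2, hs.reducedEntry_eq]
  · rw [hF p p.2, ← stateEquiv_symm_fst, hs.2.2.2.2]
    rfl
  · exact ((hs.tableClosed_iff _).1 hA).accepts_reducedNFA
      (fun p q h => (hAS p p.2 q q.2 h).2.2) _ hs.1
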